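/- **Setting.** Let $G$ be a $2$-vertex-connected outerplanar graph (simple, finite, at least three vertices, vertex set $\{0,\dots,n-1\}$) with a fixed outerplanar embedding, i.e. a plane embedding (recorded as a rotation system satisfying Euler's formula) whose exterior face $f_{ext}$ contains all vertices. For a face $f$ let $E(f)$ be the set of edges on its boundary; edges in $E(f_{ext})$ are *external*. The *weak dual* $\tilde T$ of $G$ has a vertex $v_f$ for every interior face $f\neq f_{ext}$, and $v_f,v_g$ ($f\ne g$) are adjacent iff $|E(f)\cap E(g)|=1$. Put $w(v_f)=|E(f)|-2$ and $S=\{v_f : E(f)\cap E(f_{ext})\neq\emptyset\}$. A *tree $S$-partition* of $\tilde T$ is a partition $\pi$ of $V(\tilde T)$ such that for every part $A$ the induced graph $\tilde T[A]$ is a tree and $|A\cap S|=1$; its cost is $\max_{A\in\pi}\sum_{v\in A}w(v)$. A *tree $t$-spanner* of $G$ is a spanning tree $T$ of $G$ with $d_T(x,y)\le t\, d_G(x,y)$ for all vertices $x,y$. **Model.** Algorithms run on a random access machine with finitely many registers and arrays, whose unit-cost instructions are loading constants, addition, truncated subtraction, indexed loads and stores, and comparison tests controlling branches and loops. The input consists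 of $G$, given as a list of its edges (in any order), and $\pi$, given as a list of its parts, each part as a list of interior faces, each face $f$ as a list of the positions of the edges of $E(f)$ in the edge list (all in any order). The output is the list of the edges of the constructed graph. **Theorem.** There are a single program and a constant $c$ such that for every such $G$ with its embedding, every $t\in\mathbb N$, every tree $S$-partition $\pi$ of $\tilde T$ with $\mathrm{cost}(\pi)\le t-1$, and every such representation of $G$ and $\pi$, the program halts after at most $c\,|V(G)|$ steps, without ever producing a number larger than $c\,|V(G)|$, and outputs a tree $t$-spanner $T$ of $G$. Moreover, $T$ arises from $G$ as follows: for every part $A$ of $\pi$ let $G_A$ be the subgraph formed by the edges of the faces in $A$ and let $X_A$ be the set of its internal edges, i.e. those lying on two distinct faces of $A$; delete all the sets $X_A$, and then, for every part $A$, delete one external edge lying in $E(G_A)\setminus X_A$, the boundary of the face into which the faces of $A$ have been merged. -/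

import Mathlib

namespace OuterSpanner

noncomputable section

/-! ### Plane embeddings, faces and the weak dual -/

section Embedding

variable {V : Type*}

/-- `G` is 2-(vertex-)connected: it has at least three vertices, is connected, and stays connected
when any single vertex is removed. -/
structure IsTwoConnected [Fintype V] (G : SimpleGraph V) : Prop where
  three_le : 3 ≤ Fintype.card V
  connected : G.Connected
  connected_delete : ∀ v : V, (G.induce {v}ᶜ).Connected

/-- A rotation system of `G`: for every vertex `v`, a cyclic order of the darts (oriented edges)
that leave `v`. The permutation `rot` sends a dart to the next one around its initial vertex. -/
structure RotationSystem (G : SimpleGraph V) where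
  rot : Equiv.Perm G.Dart
  rot_fst : ∀ d, (rot d).fst = d.fst
  rot_cyclic : ∀ d d' : G.Dart, d.fst = d'.fst → rot.SameCycle d d'

/-- Reversal of darts. -/
def revDart (G : SimpleGraph V) : Equiv.Perm G.Dart where
  toFun := SimpleGraph.Dart.symm
  invFun := SimpleGraph.Dart.symm
  left_inv := SimpleGraph.Dart.symm_symm
  right_inv := SimpleGraph.Dart.symm_symm

/-- The face-tracing permutation: from the dart `u → v`, continue with the dart that follows
`v → u` in the rotation at `v`. -/
def RotationSystem.facePerm {G : SimpleGraph V} (R : RotationSystem G) : Equiv.Perm G.Dart :=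
  (revDart G).trans R.rot

/-- The faces of the embedding: the orbits of the face-tracing permutation. -/
def RotationSystem.Face {G : SimpleGraph V} (R : RotationSystem G) : Type _ :=
  Quotient (Equiv.Perm.SameCycle.setoid R.facePerm)

/-- The face that is traced by (lies on a fixed side of) the dart `d`. -/
def RotationSystem.faceOf {G : SimpleGraph V} (R : RotationSystem G) (d : G.Dart) : R.Face :=
  Quotient.mk (Equiv.Perm.SameCycle.setoid R.facePerm) d

/-- An outerplanar embedding of a connected graph `G` with at least one edge, given combinatorially:
a rotation system of genus zero (by Euler's formula, `|V| - |E| + |F| = 2`) together with an exterior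
face whose boundary contains all vertices. -/
structure OuterplanarEmbedding (G : SimpleGraph V) extends RotationSystem G where
  euler : Nat.card V + Nat.card toRotationSystem.Face = G.edgeSet.ncard + 2
  ext : toRotationSystem.Face
  mem_ext : ∀ v : V, ∃ d : G.Dart, toRotationSystem.faceOf d = ext ∧ d.fst = v

namespace OuterplanarEmbedding

variable {G : SimpleGraph V} (M : OuterplanarEmbedding G)

/-- `Faces(G)`. -/
abbrev Face : Type _ := M.toRotationSystem.Face

instance : DecidableEq M.Face := Classical.decEq _

instance [Finite V] : Finite M.Face :=
  have : Finite G.Dart := Finite.of_injective (fun d : G.Dart => d.toProd)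
    fun _ _ h => SimpleGraph.Dart.ext _ _ h
  inferInstanceAs (Finite (Quotient (Equiv.Perm.SameCycle.setoid M.toRotationSystem.facePerm)))

/-- `Int-faces(G)`: the faces other than the exterior one. -/
abbrev IntFace : Type _ := {f : M.Face // f ≠ M.ext}

instance [Finite V] : Fintype M.IntFace := Fintype.ofFinite _

variable [Fintype V] [DecidableEq V]

open Classical in
/-- `E(f)`: the edges on the boundary of the face `f`. -/
def faceEdges (f : M.Face) : Finset (Sym2 V) :=
  Finset.univ.filter fun e => ∃ d : G.Dart, M.faceOf d = f ∧ d.edge = e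

/-- The external edges, `E(f_ext)`. -/
def externalEdges : Finset (Sym2 V) := M.faceEdges M.ext

/-- The weak dual of `G`: its vertices are the interior faces, and two of them are adjacent when
they share exactly one edge. -/
def weakDual : SimpleGraph M.IntFace where
  Adj f g := f ≠ g ∧ (M.faceEdges f.1 ∩ M.faceEdges g.1).card = 1
  symm := ⟨fun f g h => ⟨h.1.symm, by rw [Finset.inter_comm]; exact h.2⟩⟩
  loopless := ⟨fun _ h => h.1 rfl⟩

/-- The weight `w(v_f) = |E(f)| - 2`. (In a 2-connected graph every face has at least three edges,
so the subtraction does not truncate.) -/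
def weight (f : M.IntFace) : ℕ := (M.faceEdges f.1).card - 2

open Classical in
/-- The special vertices: the `E-faces`, i.e. the interior faces that share an edge with the
exterior face. -/
def special : Finset M.IntFace :=
  Finset.univ.filter fun f => (M.faceEdges f.1 ∩ M.externalEdges).Nonempty

/-- `E(G_i)` for a set `A` of interior faces: the edges of the faces in `A`. -/
def partEdges (A : Finset M.IntFace) : Finset (Sym2 V) :=
  A.biUnion fun f => M.faceEdges f.1

open Classical in
/-- The internal edges of the subgraph formed by the faces in `A`: the edges that have a face of `A`
on both sides. -/
def partInternalEdges (A : Finset M.IntFace) : Finset (Sym2 V) :=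
  Finset.univ.filter fun e =>
    ∃ f ∈ A, ∃ g ∈ A, f ≠ g ∧ e ∈ M.faceEdges f.1 ∧ e ∈ M.faceEdges g.1

end OuterplanarEmbedding

end Embedding

/-! ### Tree S-partitions and tree spanners -/

/-- `π` is a tree `S`-partition of `T`: each part induces a tree and contains exactly one vertex
of `S`. (So the number of parts is `|S|`.) -/
def IsTreeSPartition {X : Type*} [Fintype X] [DecidableEq X] (T : SimpleGraph X) (S : Finset X)
    (π : Finpartition (Finset.univ : Finset X)) : Prop :=
  ∀ A ∈ π.parts, (T.induce (A : Set X)).IsTree ∧ (A ∩ S).card = 1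

/-- The cost of a partition: the maximum over its parts of the total weight of the part. -/
def partitionCost {X : Type*} [Fintype X] [DecidableEq X] (w : X → ℕ)
    (π : Finpartition (Finset.univ : Finset X)) : ℕ :=
  π.parts.sup fun A => ∑ x ∈ A, w x

/-- `T` is a tree `t`-spanner of `G`: a spanning tree of `G` in which every distance is at most `t`
times the distance in `G`. -/
structure IsTreeSpanner {V : Type*} (G T : SimpleGraph V) (t : ℕ) : Prop where
  le : T ≤ G
  isTree : T.IsTree
  stretch : ∀ u v : V, T.dist u v ≤ t * G.dist u v

/-- `T` arises from `G` by deleting, for every part `A` of `π`, the internal edges of the subgraph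
`G_A` formed by the faces in `A`, and then, for every part `A`, exactly one edge that is external and
lies on the remaining boundary `E(G_A) \ X_A`, which bounds the face into which `A` was merged. -/
def IsObtainedFrom {V : Type*} [Fintype V] [DecidableEq V] {G : SimpleGraph V} (M : OuterplanarEmbedding G)
    (π : Finpartition (Finset.univ : Finset M.IntFace)) (T : SimpleGraph V) : Prop :=
  ∃ ε : Finset M.IntFace → Sym2 V,
    (∀ A ∈ π.parts, ε A ∈ (M.partEdges A \ M.partInternalEdges A) ∩ M.externalEdges) ∧
    T = (G.deleteEdges {e | ∃ A ∈ π.parts, e ∈ M.partInternalEdges A}).deleteEdges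
      {e | ∃ A ∈ π.parts, e = ε A}

end

/-! ### A random access machine with step count

Programs have finitely many registers and finitely many arrays with random access; every cell holds
one word. Each elementary instruction and each test takes one step. There is no multiplication. -/

/-- The memory: `reg x` is the content of register `x`, `arr a i` is cell `i` of array `a`. -/
structure Memory where
  reg : ℕ → ℕ
  arr : ℕ → ℕ → ℕ

/-- Structured programs of the random access machine. Register and array names are literals. -/
inductive Prog where
  | skip : Prog
  /-- `x := k` -/
  | const (x k : ℕ) : Prog
  /-- `x := y + z` -/
  | add (x y z : ℕ) : Prog
  /-- `x := y - z`, truncated at zero -/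
  | sub (x y z : ℕ) : Prog
  /-- `x := a[y]` -/
  | load (x a y : ℕ) : Prog
  /-- `a[x] := y` -/
  | store (a x y : ℕ) : Prog
  | seq (p q : Prog) : Prog
  /-- `if x < y then p else q` -/
  | ifLt (x y : ℕ) (p q : Prog) : Prog
  /-- `while x < y do p` -/
  | whileLt (x y : ℕ) (p : Prog) : Prog

/-- Writing a register. -/
def Memory.setReg (s : Memory) (x v : ℕ) : Memory :=
  { s with reg := Function.update s.reg x v }

/-- Writing an array cell. -/
def Memory.setArr (s : Memory) (a i v : ℕ) : Memory :=
  { s with arr := Function.update s.arr a (Function.update (s.arr a) i v) }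

/-- `Exec W p s k s'`: the program `p`, started in memory `s`, halts in memory `s'` after exactly `k`
steps, and no number above the word bound `W` is produced on the way (a program that would produce a
larger number has no execution). -/
inductive Exec (W : ℕ) : Prog → Memory → ℕ → Memory → Prop where
  | skip (s : Memory) : Exec W .skip s 1 s
  | const (s : Memory) (x k : ℕ) (h : k ≤ W) : Exec W (.const x k) s 1 (s.setReg x k)
  | add (s : Memory) (x y z : ℕ) (h : s.reg y + s.reg z ≤ W) :
      Exec W (.add x y z) s 1 (s.setReg x (s.reg y + s.reg z))
  | sub (s : Memory) (x y z : ℕ) : Exec W (.sub x y z) s 1 (s.setReg x (s.reg y - s.reg z))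
  | load (s : Memory) (x a y : ℕ) : Exec W (.load x a y) s 1 (s.setReg x (s.arr a (s.reg y)))
  | store (s : Memory) (a x y : ℕ) : Exec W (.store a x y) s 1 (s.setArr a (s.reg x) (s.reg y))
  | seq {p q : Prog} {s s' s'' : Memory} {k l : ℕ} (hp : Exec W p s k s') (hq : Exec W q s' l s'') :
      Exec W (.seq p q) s (k + l) s''
  | ifTrue {x y : ℕ} {p q : Prog} {s s' : Memory} {k : ℕ} (h : s.reg x < s.reg y)
      (hp : Exec W p s k s') : Exec W (.ifLt x y p q) s (k + 1) s'
  | ifFalse {x y : ℕ} {p q : Prog} {s s' : Memory} {k : ℕ} (h : ¬ s.reg x < s.reg y)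
      (hq : Exec W q s k s') : Exec W (.ifLt x y p q) s (k + 1) s'
  | whileTrue {x y : ℕ} {p : Prog} {s s' s'' : Memory} {k l : ℕ} (h : s.reg x < s.reg y)
      (hp : Exec W p s k s') (hw : Exec W (.whileLt x y p) s' l s'') :
      Exec W (.whileLt x y p) s (k + l + 1) s''
  | whileFalse {x y : ℕ} {p : Prog} {s : Memory} (h : ¬ s.reg x < s.reg y) :
      Exec W (.whileLt x y p) s 1 s

/-- The initial memory: the input words are in array `0`, everything else is zero. -/
def initialMemory (input : List ℕ) : Memory where
  reg := fun _ => 0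
  arr := fun a i => if a = 0 then input.getD i 0 else 0

/-- The memory holds the output `out`: array `1` begins with these words. -/
def HasOutput (s : Memory) (out : List ℕ) : Prop :=
  ∀ i : ℕ, ∀ h : i < out.length, s.arr 1 i = out[i]

/-! ### Representation of graphs and partitions by words -/

/-- The `j`-th edge of a list of edges. -/
def edgeAt {n : ℕ} (es : List (Fin n × Fin n)) (j : Fin es.length) : Sym2 (Fin n) :=
  s((es.get j).1, (es.get j).2)

/-- `es` lists every edge of `G` exactly once (in any order, each edge in any orientation). -/
def IsEdgeList {n : ℕ} (G : SimpleGraph (Fin n)) (es : List (Fin n × Fin n)) : Prop :=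
  Function.Injective (edgeAt es) ∧ Set.range (edgeAt es) = G.edgeSet

/-- `n`, the number of edges, and the end vertices of the edges. -/
def graphWords {n : ℕ} (es : List (Fin n × Fin n)) : List ℕ :=
  n :: es.length :: es.flatMap fun p => [p.1.val, p.2.val]

/-- `ps` represents the partition `π` of the interior faces: it lists the parts, for every part its
faces, and for every face `f` the positions in `es` of the edges of `f`, each exactly once and
in any order. -/
def RepresentsPartition {n : ℕ} {G : SimpleGraph (Fin n)} (M : OuterplanarEmbedding G)
    (es : List (Fin n × Fin n)) (π : Finpartition (Finset.univ : Finset M.IntFace))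
    (ps : List (List (List (Fin es.length)))) : Prop :=
  ∃ fs : List (List M.IntFace),
    (∀ l ∈ fs, l.Nodup) ∧
    (fs.map List.toFinset).Nodup ∧ (∀ A, A ∈ fs.map List.toFinset ↔ A ∈ π.parts) ∧
    List.Forall₂ (List.Forall₂ fun (f : M.IntFace) (c : List (Fin es.length)) =>
      c.Nodup ∧ ∀ j, j ∈ c ↔ edgeAt es j ∈ M.faceEdges f.1) fs ps

/-- The number of parts; for every part the number of its faces; for every face the number of its
edges, followed by their positions. -/
def partitionWords {m : ℕ} (ps : List (List (List (Fin m)))) : List ℕ :=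
  ps.length :: ps.flatMap fun part =>
    part.length :: part.flatMap fun face => face.length :: face.map Fin.val

end OuterSpanner

open OuterSpanner

/-! The topology is linear algebra over `ZMod 2`. In a connected plane graph the face boundary map
followed by the vertex boundary map is zero, and Euler's formula makes the sequence exact by a
dimension count (`exists_faceBoundary_eq`). Hence every closed walk has a potential: a 0/1 labelling
of the faces, zero on the exterior face, that changes exactly across the edges used an odd number of
times (`exists_potential`). As the exterior boundary connects all vertices, two interior faces share
at most one edge, so sharing an edge is adjacency in the weak dual.

Since a part `A` is a tree, its merged face has at most `w(A) + 2 ≤ t + 1` boundary edges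
(`card_mergedEdges_le`). A deleted edge of `A` lies on the boundary of a set of faces of `A` whose
other boundary edges are merged edges different from the selected one. By parity the rest of that
boundary joins its ends, with at most `t` edges (`reachable_mergedEdges_erase`); this gives
connectedness and stretch. For acyclicity, the potential of a cycle in the spanner does not change
across deleted edges; these link every interior face to the exterior one, so the potential vanishes,
which is absurd.

The program reads the parts once, numbered from 1, and keeps for every edge the last label and a
class. An external edge occurs once and gets class 1; any other edge occurs twice and gets class 0
if the labels agree, 2 if they differ. A second pass, with one flag per part, drops class 0 and the
first class 1 edge of each part. Euler's formula bounds the edges by `2n - 3` and the input by a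
multiple of that, so all is linear. -/

namespace OuterSpanner

/-! ### The cycle space of a plane graph over `ZMod 2`. -/

section CycleSpace

variable {V : Type*} {G : SimpleGraph V} (R : RotationSystem G)

theorem RotationSystem.faceOf_facePerm (d : G.Dart) : R.faceOf (R.facePerm d) = R.faceOf d :=
  Quotient.sound (s := Equiv.Perm.SameCycle.setoid R.facePerm) ⟨-1, by simp⟩

theorem RotationSystem.facePerm_apply (d : G.Dart) : R.facePerm d = R.rot d.symm := rfl

theorem RotationSystem.faceOf_rot (d : G.Dart) : R.faceOf (R.rot d) = R.faceOf d.symm := by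
  rw [← R.faceOf_facePerm d.symm, R.facePerm_apply, SimpleGraph.Dart.symm_symm]

theorem RotationSystem.faceOf_surjective : Function.Surjective R.faceOf := Quotient.mk_surjective

theorem RotationSystem.facePerm_fst (d : G.Dart) : (R.facePerm d).fst = d.snd :=
  R.rot_fst d.symm

theorem RotationSystem.exists_pow_of_faceOf_eq [Finite G.Dart] {d d' : G.Dart}
    (h : R.faceOf d = R.faceOf d') : ∃ i : ℕ, (R.facePerm ^ i) d = d' :=
  (Quotient.exact h : R.facePerm.SameCycle d d').exists_nat_pow_eq

theorem sum_ite_dart_edge_eq [Fintype G.Dart] [DecidableEq (Sym2 V)] {X : Type*} [AddCommMonoid X]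
    (d₀ : G.Dart) (F : G.Dart → X) :
    ∑ d, (if d.edge = d₀.edge then F d else 0) = F d₀ + F d₀.symm := by
  classical
  rw [← Finset.sum_filter, show (Finset.univ.filter fun d : G.Dart => d.edge = d₀.edge)
    = {d₀, d₀.symm} from ?_, Finset.sum_pair d₀.symm_ne.symm]
  ext d
  simp [SimpleGraph.dart_edge_eq_iff]

/-- A function on darts that is invariant under reversal and rotation is constant. -/
theorem RotationSystem.eq_of_invariant (hG : G.Connected) {X : Type*} (F : G.Dart → X)
    (hs : ∀ d, F d.symm = F d) (hr : ∀ d, F (R.rot d) = F d) (d d' : G.Dart) : F d = F d' := by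
  have hrot : ∀ d d' : G.Dart, d.fst = d'.fst → F d = F d' := by
    intro d d' h
    obtain ⟨i, rfl⟩ := R.rot_cyclic d d' h
    have hi : ∀ d, F (R.rot⁻¹ d) = F d := fun d => by
      rw [← hr (R.rot⁻¹ d)]; simp
    clear h
    induction i using Int.induction_on generalizing d with
    | zero => simp
    | succ i ih => rw [zpow_add_one, Equiv.Perm.mul_apply, ← ih, hr]
    | pred i ih => rw [zpow_sub_one, Equiv.Perm.mul_apply, ← ih, hi]
  -- Rotation reaches all darts at a vertex and reversal crosses an edge, so connectedness reaches
  -- every dart.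
  have hw : ∀ u v : V, G.Walk u v → ∀ d d' : G.Dart, d.fst = u → d'.fst = v → F d = F d' := by
    intro u v p
    induction p with
    | nil => rintro d d' rfl h; exact hrot _ _ h.symm
    | @cons a b c h p ih =>
      rintro d d' rfl h'
      rw [hrot d (SimpleGraph.Dart.mk (d.fst, b) h) rfl, ← hs]
      exact ih _ _ rfl h'
  exact hw _ _ (hG.preconnected d.fst d'.fst).some d d' rfl rfl

section Boundary

variable [Fintype G.Dart] [DecidableEq V]

/-- The boundary, over `ZMod 2`, of a set of faces. -/
def RotationSystem.faceBoundary : (R.Face → ZMod 2) →ₗ[ZMod 2] (G.edgeSet → ZMod 2) where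
  toFun z e := ∑ d : G.Dart, if d.edge = e then z (R.faceOf d) else 0
  map_add' z z' := by
    ext e
    simp only [Pi.add_apply, ← Finset.sum_add_distrib]
    exact Finset.sum_congr rfl fun d _ => by split_ifs <;> simp
  map_smul' r z := by
    ext e
    simp [Finset.mul_sum]

variable (G) in
/-- The boundary, over `ZMod 2`, of a set of edges. -/
def vertexBoundary : (G.edgeSet → ZMod 2) →ₗ[ZMod 2] (V → ZMod 2) where
  toFun x w := ∑ d : G.Dart, if d.fst = w then x ⟨d.edge, d.edge_mem⟩ else 0
  map_add' z z' := by
    ext e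
    simp only [Pi.add_apply, ← Finset.sum_add_distrib]
    exact Finset.sum_congr rfl fun d _ => by split_ifs <;> simp
  map_smul' r z := by
    ext e
    simp [Finset.mul_sum]

theorem RotationSystem.faceBoundary_apply (z : R.Face → ZMod 2) (d : G.Dart) :
    R.faceBoundary z ⟨d.edge, d.edge_mem⟩ = z (R.faceOf d) + z (R.faceOf d.symm) :=
  sum_ite_dart_edge_eq d fun d => z (R.faceOf d)

theorem vertexBoundary_apply (x : G.edgeSet → ZMod 2) (w : V) :
    vertexBoundary G x w = ∑ d : G.Dart, if d.fst = w then x ⟨d.edge, d.edge_mem⟩ else 0 := rfl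

/-- Rotation permutes the darts leaving `w` and carries the face on one side of a dart to the face
on the other side of the next. The two halves of the sum at `w` therefore agree and cancel. -/
theorem RotationSystem.vertexBoundary_faceBoundary (z : R.Face → ZMod 2) :
    vertexBoundary G (R.faceBoundary z) = 0 := by
  ext w
  simp only [vertexBoundary_apply, R.faceBoundary_apply, Pi.zero_apply]
  have h : ∑ d : G.Dart, (if d.fst = w then z (R.faceOf d.symm) else 0)
      = ∑ d : G.Dart, if d.fst = w then z (R.faceOf d) else 0 := by
    rw [← Equiv.sum_comp R.rot fun d => if d.fst = w then z (R.faceOf d) else 0]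
    simp only [R.rot_fst, R.faceOf_rot]
  calc _ = ∑ d : G.Dart, ((if d.fst = w then z (R.faceOf d) else 0)
        + if d.fst = w then z (R.faceOf d.symm) else 0) :=
        Finset.sum_congr rfl fun d _ => by split_ifs <;> simp
    _ = 0 := by rw [Finset.sum_add_distrib, h, CharTwo.add_self_eq_zero]

/-- The edges of a walk, counted modulo two. -/
def walkVector {u v : V} (p : G.Walk u v) (e : G.edgeSet) : ZMod 2 := p.edges.count e.1

/-- The inner vertices of the walk cancel in pairs; in particular a closed walk lies in the kernel.
-/
theorem vertexBoundary_walkVector {u v : V} (p : G.Walk u v) :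
    vertexBoundary G (walkVector p) = Pi.single u 1 + Pi.single v 1 := by
  induction p with
  | nil =>
    rw [ZModModule.add_self]
    ext w
    simp [vertexBoundary_apply, walkVector]
  | @cons a b c h p ih =>
    have h1 : walkVector (SimpleGraph.Walk.cons h p)
        = (fun e => if e.1 = s(a, b) then 1 else 0) + walkVector p := by
      ext e
      simp only [walkVector, SimpleGraph.Walk.edges_cons, List.count_cons, Pi.add_apply, beq_iff_eq,
        Nat.cast_add, Nat.cast_ite, Nat.cast_one, Nat.cast_zero, eq_comm (a := e.1)]
      ring
    have h2 : vertexBoundary G (fun e => if e.1 = s(a, b) then 1 else 0)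
        = Pi.single a 1 + Pi.single b 1 := by
      ext w
      have := sum_ite_dart_edge_eq (⟨(a, b), h⟩ : G.Dart)
        (fun d => if d.fst = w then (1 : ZMod 2) else 0)
      rw [vertexBoundary_apply]
      simp only [Pi.add_apply, Pi.single_apply]
      rw [if_congr (eq_comm (a := w)) rfl rfl, if_congr (eq_comm (a := w) (b := b)) rfl rfl]
      refine Eq.trans (Finset.sum_congr rfl fun d _ => ?_) this
      change _ = if d.edge = s(a, b) then _ else _
      split_ifs <;> rfl
    rw [h1, map_add, h2, ih, add_assoc, ← add_assoc (Pi.single b 1), ZModModule.add_self,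
      zero_add]

end Boundary

open Module in
/-- In a plane embedding of a connected graph every cycle is a sum of face boundaries. -/
theorem RotationSystem.exists_faceBoundary_eq [Fintype V] [DecidableEq V] [Fintype G.Dart]
    (hG : G.Connected) (hE : Nat.card V + Nat.card R.Face = G.edgeSet.ncard + 2)
    (x : G.edgeSet → ZMod 2) (hx : vertexBoundary G x = 0) : ∃ z, R.faceBoundary z = x := by
  classical
  have : Finite R.Face := Finite.of_surjective _ R.faceOf_surjective
  have : Fintype R.Face := Fintype.ofFinite _
  have hle : LinearMap.range R.faceBoundary ≤ LinearMap.ker (vertexBoundary G) := by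
    rintro _ ⟨z, rfl⟩
    exact R.vertexBoundary_faceBoundary z
  -- A face labelling with zero boundary agrees on both sides of every edge, hence is constant.
  have hker : finrank (ZMod 2) (LinearMap.ker R.faceBoundary) ≤ 1 := by
    refine (Submodule.finrank_mono (t := Submodule.span (ZMod 2) {fun _ => 1}) ?_).trans
      ((finrank_span_le_card _).trans (by simp))
    intro z hz
    rw [Submodule.mem_span_singleton]
    have hz' : ∀ d, z (R.faceOf d.symm) = z (R.faceOf d) := fun d => by
      have := R.faceBoundary_apply z d
      rw [LinearMap.mem_ker.1 hz, Pi.zero_apply, eq_comm, CharTwo.add_eq_zero] at this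
      exact this.symm
    by_cases hF : Nonempty R.Face
    · obtain ⟨f₀⟩ := hF
      refine ⟨z f₀, funext fun f => ?_⟩
      obtain ⟨d₀, rfl⟩ := R.faceOf_surjective f₀
      obtain ⟨d, rfl⟩ := R.faceOf_surjective f
      have := R.eq_of_invariant hG (fun d => z (R.faceOf d)) hz'
        (fun d => by rw [R.faceOf_rot, hz']) d₀ d
      simpa using this
    · exact ⟨0, funext fun f => (hF ⟨f⟩).elim⟩
  obtain ⟨r⟩ := hG.nonempty
  -- Walks to a root `r` show that the range and one further vector span everything.
  have hrange : Fintype.card V ≤ finrank (ZMod 2) (LinearMap.range (vertexBoundary G)) + 1 := by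
    have htop : LinearMap.range (vertexBoundary G) ⊔
        Submodule.span (ZMod 2) {(Pi.single r 1 : V → ZMod 2)} = ⊤ := by
      rw [eq_top_iff, ← (Pi.basisFun (ZMod 2) V).span_eq, Submodule.span_le]
      rintro _ ⟨v, rfl⟩
      rw [Pi.basisFun_apply]
      have hp := vertexBoundary_walkVector (hG.preconnected v r).some
      have : (Pi.single v 1 : V → ZMod 2) = (Pi.single v 1 + Pi.single r 1) + Pi.single r 1 := by
        rw [add_assoc, ZModModule.add_self, add_zero]
      rw [this, ← hp]
      exact Submodule.add_mem_sup ⟨_, rfl⟩ (Submodule.mem_span_singleton_self _)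
    have h1 := Submodule.finrank_add_le_finrank_add_finrank (LinearMap.range (vertexBoundary G))
      (Submodule.span (ZMod 2) {(Pi.single r 1 : V → ZMod 2)})
    rw [htop, finrank_top, finrank_fintype_fun_eq_card] at h1
    exact h1.trans (Nat.add_le_add_left ((finrank_span_le_card _).trans (by simp)) _)
  have e1 := LinearMap.finrank_range_add_finrank_ker R.faceBoundary
  have e2 := LinearMap.finrank_range_add_finrank_ker (vertexBoundary G)
  rw [finrank_fintype_fun_eq_card] at e1 e2
  rw [Nat.card_eq_fintype_card, Nat.card_eq_fintype_card, ← Nat.card_coe_set_eq,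
    Nat.card_eq_fintype_card] at hE
  -- The range has dimension at least `F - 1` and the kernel at most `E - (V - 1)`, which Euler's
  -- formula makes equal.
  have heq := Submodule.eq_of_le_of_finrank_le hle (by omega)
  have : x ∈ LinearMap.range R.faceBoundary := heq ▸ LinearMap.mem_ker.2 hx
  exact this

end CycleSpace

namespace OuterplanarEmbedding

variable {V : Type*} {G : SimpleGraph V} (M : OuterplanarEmbedding G)

/-- Every closed walk is, modulo two, the boundary of a set of interior faces. -/
theorem exists_potential [Finite V] [DecidableEq V] (hG : G.Connected) {u : V} (c : G.Walk u u) :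
    ∃ z : M.Face → ZMod 2, z M.ext = 0 ∧
      ∀ d : G.Dart, z (M.faceOf d) + z (M.faceOf d.symm) = c.edges.count d.edge := by
  have := Fintype.ofFinite V
  have : Finite G.Dart := Finite.of_injective (fun d : G.Dart => d.toProd)
    fun _ _ h => SimpleGraph.Dart.ext _ _ h
  have := Fintype.ofFinite G.Dart
  obtain ⟨z, hz⟩ := M.exists_faceBoundary_eq hG M.euler (walkVector c)
    (by rw [vertexBoundary_walkVector, ZModModule.add_self])
  -- Adding a constant to `z` changes no sum of two values, so `z` may be normalised on the exterior
  -- face.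
  refine ⟨fun f => z f + z M.ext, CharTwo.add_self_eq_zero _, fun d => ?_⟩
  have := congrFun hz ⟨d.edge, d.edge_mem⟩
  rw [M.faceBoundary_apply] at this
  rw [show (c.edges.count d.edge : ZMod 2) = _ from this.symm, add_add_add_comm,
    CharTwo.add_self_eq_zero, add_zero]

end OuterplanarEmbedding

/-! ### Faces of 2-connected outerplanar graphs. -/

theorem finite_dart {V : Type*} [Finite V] (G : SimpleGraph V) : Finite G.Dart :=
  Finite.of_injective (fun d : G.Dart => d.toProd) fun _ _ h => SimpleGraph.Dart.ext _ _ h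

/-- Choose a third vertex `w` and go from `v` to `w` avoiding `u`, then from `w` to `u` avoiding
`v`: neither half can use the edge. -/
theorem IsTwoConnected.exists_walk_notMem_edges {V : Type*} [Fintype V] {G : SimpleGraph V}
    (hG : IsTwoConnected G) {u v : V} (h : G.Adj u v) : ∃ p : G.Walk v u, s(u, v) ∉ p.edges := by
  classical
  obtain ⟨w, -, hw⟩ := Finset.exists_mem_notMem_of_card_lt_card
    (s := {u, v}) (t := Finset.univ) (Finset.card_le_two.trans_lt hG.three_le)
  simp only [Finset.mem_insert, Finset.mem_singleton, not_or] at hw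
  have key : ∀ a b c : V, b ∈ ({a}ᶜ : Set V) → c ∈ ({a}ᶜ : Set V) → ∃ p : G.Walk b c, a ∉ p.support := by
    intro a b c hb hc
    obtain ⟨p⟩ := (hG.connected_delete a).preconnected ⟨b, hb⟩ ⟨c, hc⟩
    refine ⟨p.map (SimpleGraph.Embedding.induce _).toHom, ?_⟩
    intro hmem
    obtain ⟨x, -, hx⟩ := List.mem_map.1
      (Eq.mp (congrArg (a ∈ ·) (SimpleGraph.Walk.support_map _ p)) hmem)
    exact x.2 hx
  obtain ⟨p, hp⟩ := key u v w h.ne' hw.1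
  obtain ⟨q, hq⟩ := key v w u hw.2 h.ne
  refine ⟨p.append q, fun hmem => ?_⟩
  rw [SimpleGraph.Walk.edges_append, List.mem_append] at hmem
  rcases hmem with hmem | hmem
  · exact hp (p.fst_mem_support_of_mem_edges hmem)
  · exact hq (q.snd_mem_support_of_mem_edges hmem)

namespace OuterplanarEmbedding

variable {V : Type*} [Fintype V] {G : SimpleGraph V} (M : OuterplanarEmbedding G)

/-- In a 2-connected plane graph the two sides of an edge belong to distinct faces. -/
theorem faceOf_symm_ne (hG : IsTwoConnected G) (d : G.Dart) : M.faceOf d.symm ≠ M.faceOf d := by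
  classical
  intro h
  obtain ⟨p, hp⟩ := hG.exists_walk_notMem_edges d.adj
  -- This closed walk uses the edge of `d` exactly once, so its potential must differ on the two
  -- sides.
  obtain ⟨z, -, hz⟩ := M.exists_potential hG.connected (SimpleGraph.Walk.cons d.adj p)
  have h1 := hz d
  rw [h, CharTwo.add_self_eq_zero, SimpleGraph.Walk.edges_cons] at h1
  have h2 : s(d.fst, d.snd) = d.edge := rfl
  rw [h2] at h1 hp
  rw [List.count_cons_self, List.count_eq_zero_of_not_mem hp] at h1
  simp at h1

/-- A face traced by one dart would need a loop; one traced by two would consist of a dart and its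
reverse, against `faceOf_symm_ne`. -/
theorem three_le_card_filter_faceOf (hG : IsTwoConnected G) [Fintype G.Dart] [DecidableEq M.Face]
    (f : M.Face) : 3 ≤ (Finset.univ.filter fun d => M.faceOf d = f).card := by
  classical
  obtain ⟨d, rfl⟩ := M.faceOf_surjective f
  have hne : ∀ d, M.facePerm d ≠ d := fun d h => d.adj.ne (by
    conv_lhs => rw [← h]
    exact (M.facePerm_fst d).symm ▸ rfl)
  have hne2 : M.facePerm (M.facePerm d) ≠ d := by
    intro h
    refine M.faceOf_symm_ne hG d ?_
    rw [← M.faceOf_facePerm d]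
    congr 1
    refine SimpleGraph.Dart.ext _ _ (Prod.ext (M.facePerm_fst d).symm ?_)
    change d.fst = (M.facePerm d).snd
    rw [← M.facePerm_fst, h]
  rw [← Finset.card_eq_three.2 ⟨d, M.facePerm d, M.facePerm (M.facePerm d), (hne d).symm,
    hne2.symm, (hne _).symm, rfl⟩]
  refine Finset.card_le_card fun x hx => ?_
  simp only [Finset.mem_insert, Finset.mem_singleton] at hx
  rw [Finset.mem_filter]
  rcases hx with rfl | rfl | rfl <;> simp [M.faceOf_facePerm]

/-- Counting darts by faces gives `2m ≥ n + 3(F - 1)`, because the exterior face has a dart leaving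
each vertex; now insert `F = m + 2 - n`. -/
theorem card_edgeSet_add_three_le {G : SimpleGraph V} (M : OuterplanarEmbedding G)
    (hG : IsTwoConnected G) :
    G.edgeSet.ncard + 3 ≤ 2 * Fintype.card V := by
  classical
  have := Fintype.ofFinite M.Face
  have h1 : ∑ f : M.Face, (Finset.univ.filter fun d : G.Dart => M.faceOf d = f).card
      = 2 * G.edgeSet.ncard := by
    rw [← Finset.card_eq_sum_card_fiberwise (fun _ _ => Finset.mem_coe.2 (Finset.mem_univ _)),
      Finset.card_univ, G.dart_card_eq_twice_card_edges, ← SimpleGraph.coe_edgeFinset,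
      Set.ncard_coe_finset]
  have h2 : Fintype.card V ≤ (Finset.univ.filter fun d : G.Dart => M.faceOf d = M.ext).card := by
    choose d hd hd' using M.mem_ext
    rw [← Finset.card_univ]
    refine Finset.card_le_card_of_injOn d (fun v _ => by simp [hd]) fun v _ w _ h => ?_
    rw [← hd' v, h, hd']
  have h3 : (Finset.univ.erase M.ext).card * 3 ≤ ∑ f ∈ Finset.univ.erase M.ext,
      (Finset.univ.filter fun d : G.Dart => M.faceOf d = f).card := by
    refine (Finset.card_nsmul_le_sum _ _ _ fun f _ => M.three_le_card_filter_faceOf hG f)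
  rw [← Finset.add_sum_erase _ _ (Finset.mem_univ M.ext)] at h1
  have h4 := Finset.card_erase_of_mem (Finset.mem_univ M.ext)
  have h5 := M.euler
  rw [Nat.card_eq_fintype_card, Nat.card_eq_fintype_card] at h5
  rw [Finset.card_univ] at h4
  omega

variable [DecidableEq V]

theorem mem_faceEdges {f : M.Face} {e : Sym2 V} :
    e ∈ M.faceEdges f ↔ ∃ d : G.Dart, M.faceOf d = f ∧ d.edge = e := by
  simp [faceEdges]

theorem edge_mem_faceEdges {f : M.Face} {d : G.Dart} :
    d.edge ∈ M.faceEdges f ↔ f = M.faceOf d ∨ f = M.faceOf d.symm := by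
  rw [mem_faceEdges]
  constructor
  · rintro ⟨d', rfl, h⟩
    rcases (SimpleGraph.dart_edge_eq_iff _ _).1 h with rfl | rfl
    · exact Or.inl rfl
    · exact Or.inr rfl
  · rintro (rfl | rfl)
    · exact ⟨d, rfl, rfl⟩
    · exact ⟨d.symm, rfl, d.edge_symm⟩

theorem exists_dart_of_mem {f g : M.Face} (h : f ≠ g) {e : Sym2 V} (hf : e ∈ M.faceEdges f)
    (hg : e ∈ M.faceEdges g) : ∃ d : G.Dart, M.faceOf d = f ∧ M.faceOf d.symm = g ∧ d.edge = e := by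
  obtain ⟨d, rfl, rfl⟩ := M.mem_faceEdges.1 hf
  rcases M.edge_mem_faceEdges.1 hg with rfl | rfl
  · exact (h rfl).elim
  · exact ⟨d, rfl, rfl, rfl⟩

/-- An edge lies on at most two faces. -/
theorem eq_or_eq_of_mem {f g h : M.Face} (hfg : f ≠ g) {e : Sym2 V} (hf : e ∈ M.faceEdges f)
    (hg : e ∈ M.faceEdges g) (hh : e ∈ M.faceEdges h) : h = f ∨ h = g := by
  obtain ⟨d, rfl, rfl, rfl⟩ := M.exists_dart_of_mem hfg hf hg
  exact M.edge_mem_faceEdges.1 hh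

theorem mem_edgeSet_of_mem_faceEdges {f : M.Face} {e : Sym2 V} (h : e ∈ M.faceEdges f) :
    e ∈ G.edgeSet := by
  obtain ⟨d, -, rfl⟩ := M.mem_faceEdges.1 h
  exact d.edge_mem

/-- Tracing the exterior face walks along external edges and meets every vertex. -/
theorem reachable_fromEdgeSet_externalEdges (u v : V) :
    (SimpleGraph.fromEdgeSet (M.externalEdges : Set (Sym2 V))).Reachable u v := by
  have := finite_dart G
  obtain ⟨d, hd, rfl⟩ := M.mem_ext u
  obtain ⟨d', hd', rfl⟩ := M.mem_ext v
  obtain ⟨i, rfl⟩ := M.exists_pow_of_faceOf_eq (hd.trans hd'.symm)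
  clear hd'
  induction i generalizing d with
  | zero => exact SimpleGraph.Reachable.refl _
  | succ i ih =>
    rw [pow_succ, Equiv.Perm.mul_apply]
    refine SimpleGraph.Reachable.trans (SimpleGraph.Adj.reachable ?_)
      (ih (M.facePerm d) ((M.faceOf_facePerm d).trans hd))
    rw [SimpleGraph.fromEdgeSet_adj, M.facePerm_fst]
    exact ⟨Finset.mem_coe.2 (M.mem_faceEdges.2 ⟨d, hd, rfl⟩), d.adj.ne⟩

/-- Two interior faces of an outerplanar graph share at most one edge. -/
theorem eq_of_mem_faceEdges (hG : G.Connected) {f g : M.IntFace} (hfg : f ≠ g) {e e' : Sym2 V}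
    (hf : e ∈ M.faceEdges f.1) (hg : e ∈ M.faceEdges g.1) (hf' : e' ∈ M.faceEdges f.1)
    (hg' : e' ∈ M.faceEdges g.1) : e' = e := by
  by_contra hne
  have hfg' : f.1 ≠ g.1 := fun h => hfg (Subtype.ext h)
  have hext : ∀ e, e ∈ M.faceEdges f.1 → e ∈ M.faceEdges g.1 → e ∉ M.externalEdges := by
    intro e hf hg he
    rcases M.eq_or_eq_of_mem hfg' hf hg he with h | h
    · exact f.2 h.symm
    · exact g.2 h.symm
  have hle : SimpleGraph.fromEdgeSet (M.externalEdges : Set (Sym2 V)) ≤ G := by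
    intro u v h
    rw [SimpleGraph.fromEdgeSet_adj] at h
    exact M.mem_edgeSet_of_mem_faceEdges (Finset.mem_coe.1 h.1)
  obtain ⟨d, hd, hd', rfl⟩ := M.exists_dart_of_mem hfg' hf hg
  obtain ⟨d₂, hd₂, hd₂', rfl⟩ := M.exists_dart_of_mem hfg' hf' hg'
  obtain ⟨p⟩ := M.reachable_fromEdgeSet_externalEdges d.snd d.fst
  have hp : ∀ e ∈ (p.mapLe hle).edges, e ∈ M.externalEdges := by
    intro e he
    rw [SimpleGraph.Walk.edges_mapLe_eq_edges] at he
    have := p.edges_subset_edgeSet he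
    rw [SimpleGraph.edgeSet_fromEdgeSet] at this
    exact Finset.mem_coe.1 this.1
  -- The edge of `d` is closed up through external edges only. The potential then changes between
  -- `f` and `g` across `d`, but not across `d₂`, which joins the same two faces.
  obtain ⟨z, -, hz⟩ := M.exists_potential hG (SimpleGraph.Walk.cons d.adj (p.mapLe hle))
  have h1 := (hz d).symm.trans ((by rw [hd, hd', hd₂, hd₂'] :
    z (M.faceOf d) + z (M.faceOf d.symm) = z (M.faceOf d₂) + z (M.faceOf d₂.symm)).trans (hz d₂))
  rw [SimpleGraph.Walk.edges_cons, show s(d.fst, d.snd) = d.edge from rfl, List.count_cons_self,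
    List.count_cons_of_ne (Ne.symm hne), List.count_eq_zero_of_not_mem fun h => hext _ hf hg (hp _ h),
    List.count_eq_zero_of_not_mem fun h => hext _ hf' hg' (hp _ h)] at h1
  simp at h1

end OuterplanarEmbedding

/-! ### Merged faces and the spanner property. -/

theorem exists_walk_length_le_card {V : Type*} {B : Finset (Sym2 V)} {u v : V}
    (h : (SimpleGraph.fromEdgeSet (B : Set (Sym2 V))).Reachable u v) :
    ∃ p : (SimpleGraph.fromEdgeSet (B : Set (Sym2 V))).Walk u v, p.length ≤ B.card := by
  classical
  obtain ⟨p⟩ := h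
  refine ⟨p.toPath, ?_⟩
  rw [← SimpleGraph.Walk.length_edges, ← List.toFinset_card_of_nodup p.toPath.2.isTrail.edges_nodup]
  refine Finset.card_le_card fun e he => ?_
  have := p.toPath.1.edges_subset_edgeSet (List.mem_toFinset.1 he)
  rw [SimpleGraph.edgeSet_fromEdgeSet] at this
  exact Finset.mem_coe.1 this.1

/-- Deleting an edge of a tree leaves two sides; one of them avoids a given vertex. -/
theorem exists_side_of_isTree {X : Type*} {H : SimpleGraph X} (hH : H.IsAcyclic) {f g : X}
    (hfg : H.Adj f g) (x : X) : ∃ Z : Set X, x ∉ Z ∧ (f ∈ Z ↔ g ∉ Z) ∧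
      ∀ a b, H.Adj a b → s(a, b) ≠ s(f, g) → (a ∈ Z ↔ b ∈ Z) := by
  have hb := SimpleGraph.isBridge_iff.1
    (SimpleGraph.isAcyclic_iff_forall_adj_isBridge.1 hH hfg)
  set H' := H.deleteEdges {s(f, g)} with hH'
  have hadj : ∀ a b, H.Adj a b → s(a, b) ≠ s(f, g) → H'.Adj a b := fun a b h hne => by
    rw [hH', SimpleGraph.deleteEdges_adj]
    exact ⟨h, hne⟩
  have hside : ∀ r a b, H.Adj a b → s(a, b) ≠ s(f, g) → (H'.Reachable r a ↔ H'.Reachable r b) :=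
    fun r a b h hne => ⟨fun h' => h'.trans (hadj a b h hne).reachable,
      fun h' => h'.trans (hadj a b h hne).symm.reachable⟩
  by_cases hx : H'.Reachable f x
  · exact ⟨{a | H'.Reachable g a}, fun h => hb (hx.trans h.symm),
      iff_of_false (fun h => hb h.symm) (not_not_intro (SimpleGraph.Reachable.refl g)), hside g⟩
  · exact ⟨{a | H'.Reachable f a}, hx, iff_of_true (SimpleGraph.Reachable.refl f) hb, hside f⟩

namespace OuterplanarEmbedding

variable {V : Type*} [Fintype V] [DecidableEq V] {G : SimpleGraph V} (M : OuterplanarEmbedding G)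

/-- The ends of an edge on the boundary of a set of faces are joined by the rest of the
boundary. -/
theorem reachable_of_boundary (Z : Set M.Face) (B : Finset (Sym2 V)) (d₀ : G.Dart)
    (h₀ : M.faceOf d₀ ∈ Z ↔ M.faceOf d₀.symm ∉ Z)
    (hB : ∀ d : G.Dart, M.faceOf d ∈ Z → M.faceOf d.symm ∉ Z → d.edge ≠ d₀.edge → d.edge ∈ B) :
    (SimpleGraph.fromEdgeSet (B : Set (Sym2 V))).Reachable d₀.fst d₀.snd := by
  classical
  by_contra hr
  set H := SimpleGraph.fromEdgeSet (B : Set (Sym2 V)) with hH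
  let z : M.Face → ZMod 2 := fun f => if f ∈ Z then 1 else 0
  -- A handshake argument: `F` marks the darts on the boundary of `Z` that leave the component of
  -- `d₀.fst` in `H`. Every vertex meets the boundary evenly, so the sum of `F` is zero; pairing
  -- each dart with its reverse leaves only the contribution 1 of `d₀`.
  let F : G.Dart → ZMod 2 := fun d =>
    if H.Reachable d₀.fst d.fst then z (M.faceOf d) + z (M.faceOf d.symm) else 0
  have hx : z (M.faceOf d₀) + z (M.faceOf d₀.symm) = 1 := by
    by_cases h : M.faceOf d₀ ∈ Z
    · simp [z, h, h₀.1 h]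
    · have : M.faceOf d₀.symm ∈ Z := by_contra fun h' => h (h₀.2 h')
      simp [z, h, this]
  have hF0 : F d₀ = 1 := by simp [F, hx]
  have hF1 : F d₀.symm = 0 := if_neg hr
  have hF : ∀ d : G.Dart, d.edge ≠ d₀.edge → F d = F d.symm := by
    intro d hd
    by_cases hz : z (M.faceOf d) + z (M.faceOf d.symm) = 0
    · have hz' := hz
      rw [add_comm] at hz'
      simp [F, hz, hz']
    · have hmem : d.edge ∈ B := by
        by_cases h1 : M.faceOf d ∈ Z <;> by_cases h2 : M.faceOf d.symm ∈ Z
        · simp [z, h1, h2, CharTwo.add_self_eq_zero] at hz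
        · exact hB d h1 h2 hd
        · rw [← d.edge_symm]
          exact hB d.symm h2 (by rwa [d.symm_symm]) (by rwa [d.edge_symm])
        · simp [z, h1, h2] at hz
      have hadj : H.Adj d.fst d.snd := by
        rw [hH, SimpleGraph.fromEdgeSet_adj]
        exact ⟨Finset.mem_coe.2 hmem, d.adj.ne⟩
      have hiff : H.Reachable d₀.fst d.fst ↔ H.Reachable d₀.fst d.symm.fst :=
        ⟨fun h => h.trans hadj.reachable, fun h => h.trans hadj.symm.reachable⟩
      simp only [F, hiff, d.symm_symm]
      rw [add_comm]
  have hsum : ∑ d : G.Dart, F d = 0 := by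
    have h1 : ∀ w, (∑ d : G.Dart, if d.fst = w then
        z (M.faceOf d) + z (M.faceOf d.symm) else 0) = 0 := fun w => by
      have := congrFun (M.vertexBoundary_faceBoundary z) w
      simpa only [vertexBoundary_apply, M.faceBoundary_apply, Pi.zero_apply] using this
    rw [← Finset.sum_fiberwise Finset.univ (fun d : G.Dart => d.fst) F]
    refine Finset.sum_eq_zero fun w _ => ?_
    by_cases hw : H.Reachable d₀.fst w
    · rw [← h1 w, Finset.sum_filter]
      refine Finset.sum_congr rfl fun d _ => ?_
      by_cases hd : d.fst = w
      · simp [F, hd, hw]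
      · simp [hd]
    · refine Finset.sum_eq_zero fun d hd => if_neg ?_
      rwa [(Finset.mem_filter.1 hd).2]
  -- Adding 1 at `d₀` compensates for the only edge whose two darts have different values.
  have hinv : ∑ d : G.Dart, (F d + if d = d₀ then 1 else 0) = 0 := by
    refine Finset.sum_involution (fun d _ => d.symm) (fun d _ => ?_) (fun d _ _ => d.symm_ne)
      (fun _ _ => Finset.mem_univ _) (fun d _ => d.symm_symm)
    by_cases hd : d.edge = d₀.edge
    · rcases (SimpleGraph.dart_edge_eq_iff _ _).1 hd with rfl | rfl
      · simp [hF0, hF1, d.symm_ne, CharTwo.add_self_eq_zero]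
      · simp [hF0, hF1, d₀.symm_ne, CharTwo.add_self_eq_zero]
    · have h1 : d ≠ d₀ := fun h => hd (h ▸ rfl)
      have h2 : d.symm ≠ d₀ := fun h => hd (by rw [← h, d.edge_symm])
      simp [h1, h2, ← hF d hd, CharTwo.add_self_eq_zero]
  rw [Finset.sum_add_distrib, hsum] at hinv
  simp at hinv

theorem mem_partEdges {A : Finset M.IntFace} {e : Sym2 V} :
    e ∈ M.partEdges A ↔ ∃ f ∈ A, e ∈ M.faceEdges f.1 := by
  simp [partEdges]

theorem mem_partInternalEdges {A : Finset M.IntFace} {e : Sym2 V} :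
    e ∈ M.partInternalEdges A ↔
      ∃ f ∈ A, ∃ g ∈ A, f ≠ g ∧ e ∈ M.faceEdges f.1 ∧ e ∈ M.faceEdges g.1 := by
  simp [partInternalEdges]

/-- The boundary of the face into which the faces of `A` are merged. -/
noncomputable def mergedEdges (A : Finset M.IntFace) : Finset (Sym2 V) := M.partEdges A \ M.partInternalEdges A

/-- The sum of the `|E(f)|` counts merged edges at least once and internal edges at least twice, and
the `|A| - 1` edges of the tree yield that many internal edges. Hence the bound `∑ (w + 2) - 2(|A| -
1)`. -/
theorem card_mergedEdges_le {A : Finset M.IntFace}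
    (hA : (M.weakDual.induce (A : Set M.IntFace)).IsTree) :
    (M.mergedEdges A).card ≤ ∑ f ∈ A, M.weight f + 2 := by
  classical
  have hsub : M.partInternalEdges A ⊆ M.partEdges A := by
    intro e he
    obtain ⟨f, hf, -, -, -, hef, -⟩ := M.mem_partInternalEdges.1 he
    exact M.mem_partEdges.2 ⟨f, hf, hef⟩
  have h1 : ∑ f ∈ A, (M.faceEdges f.1).card
      = ∑ e ∈ M.partEdges A, (A.filter fun f => e ∈ M.faceEdges f.1).card := by
    refine Eq.trans ?_ (Finset.sum_card_bipartiteAbove_eq_sum_card_bipartiteBelow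
      (fun (f : M.IntFace) (e : Sym2 V) => e ∈ M.faceEdges f.1))
    refine Finset.sum_congr rfl fun f hf => congrArg Finset.card ?_
    ext e
    simp only [Finset.bipartiteAbove, Finset.mem_filter]
    exact ⟨fun h => ⟨M.mem_partEdges.2 ⟨f, hf, h⟩, h⟩, fun h => h.2⟩
  have h2 : (M.mergedEdges A).card + (M.partInternalEdges A).card * 2
      ≤ ∑ f ∈ A, (M.faceEdges f.1).card := by
    rw [h1, ← Finset.sum_sdiff hsub, ← smul_eq_mul]
    refine add_le_add ?_ (Finset.card_nsmul_le_sum _ _ _ fun e he => ?_)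
    · refine (Eq.le (by simp [mergedEdges])).trans (Finset.card_nsmul_le_sum _ _ 1 fun e he => ?_)
      obtain ⟨f, hf, hef⟩ := M.mem_partEdges.1 (Finset.mem_sdiff.1 he).1
      exact Finset.card_pos.2 ⟨f, Finset.mem_filter.2 ⟨hf, hef⟩⟩
    · obtain ⟨f, hf, g, hg, hfg, hef, heg⟩ := M.mem_partInternalEdges.1 he
      exact Finset.one_lt_card.2 ⟨f, Finset.mem_filter.2 ⟨hf, hef⟩, g,
        Finset.mem_filter.2 ⟨hg, heg⟩, hfg⟩
  have h3 : ∑ f ∈ A, (M.faceEdges f.1).card ≤ ∑ f ∈ A, M.weight f + A.card * 2 := by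
    rw [← smul_eq_mul, ← Finset.sum_const, ← Finset.sum_add_distrib]
    exact Finset.sum_le_sum fun f _ => by unfold weight; omega
  have h4 : A.card ≤ (M.partInternalEdges A).card + 1 := by
    have hcard := hA.card_edgeFinset
    simp only [Finset.coe_sort_coe, Fintype.card_coe] at hcard
    -- Each dual edge is sent to an edge shared by its two faces; this is injective since an edge
    -- lies on at most two faces.
    have hex : ∀ x : Sym2 (A : Set M.IntFace), ∃ e : Sym2 V,
        x ∈ (M.weakDual.induce (A : Set M.IntFace)).edgeFinset →
          e ∈ M.partInternalEdges A ∧ ∀ f ∈ x, e ∈ M.faceEdges f.1.1 := by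
      intro x
      induction x with | _ f g =>
      by_cases h : s(f, g) ∈ (M.weakDual.induce (A : Set M.IntFace)).edgeFinset
      · have hadj : M.weakDual.Adj f.1 g.1 := by simpa using h
        obtain ⟨e, he⟩ := Finset.card_pos.1 (hadj.2.symm ▸ Nat.one_pos)
        rw [Finset.mem_inter] at he
        refine ⟨e, fun _ => ⟨M.mem_partInternalEdges.2
          ⟨f.1, f.2, g.1, g.2, hadj.1, he.1, he.2⟩, fun y hy => ?_⟩⟩
        rcases Sym2.mem_iff.1 hy with rfl | rfl
        exacts [he.1, he.2]
      -- An arbitrary default for pairs that are not dual edges.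
      · obtain ⟨v, -⟩ := M.faceOf_surjective f.1.1
        exact ⟨v.edge, fun h' => (h h').elim⟩
    choose φ hφ using hex
    rw [← hcard]
    refine Nat.add_le_add_right (Finset.card_le_card_of_injOn φ (fun x hx => (hφ x hx).1) ?_) 1
    intro x hx y hy hxy
    have hx' := hφ x hx
    have hy' := hφ y hy
    rw [hxy] at hx'
    induction x with | _ f g =>
    induction y with | _ f' g' =>
    have hfg : f ≠ g := by rintro rfl; simp at hx
    have hfg' : f' ≠ g' := by rintro rfl; simp at hy
    have hne : f.1.1 ≠ g.1.1 := fun h => hfg (Subtype.ext (Subtype.ext h))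
    have key : ∀ k : (A : Set M.IntFace), k ∈ s(f', g') → k = f ∨ k = g := fun k hk =>
      (M.eq_or_eq_of_mem hne (hx'.2 f (by simp)) (hx'.2 g (by simp)) (hy'.2 k hk)).imp
        (fun h => Subtype.ext (Subtype.ext h)) (fun h => Subtype.ext (Subtype.ext h))
    rcases key f' (by simp) with h1 | h1 <;> rcases key g' (by simp) with h2 | h2
    · exact (hfg' (h1.trans h2.symm)).elim
    · rw [h1, h2]
    · rw [h1, h2, Sym2.eq_swap]
    · exact (hfg' (h1.trans h2.symm)).elim
  omega

theorem edge_mem_mergedEdges {A : Finset M.IntFace} {d : G.Dart} {f : M.IntFace} (hf : f ∈ A)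
    (hd : M.faceOf d = f.1) (hd' : ∀ g ∈ A, M.faceOf d.symm ≠ g.1) : d.edge ∈ M.mergedEdges A := by
  refine Finset.mem_sdiff.2 ⟨M.mem_partEdges.2 ⟨f, hf, M.edge_mem_faceEdges.2 (Or.inl hd.symm)⟩,
    fun h => ?_⟩
  obtain ⟨g, hg, k, hk, hgk, heg, hek⟩ := M.mem_partInternalEdges.1 h
  rcases M.edge_mem_faceEdges.1 heg with h1 | h1
  · rcases M.edge_mem_faceEdges.1 hek with h2 | h2
    · exact hgk (Subtype.ext (h1.trans h2.symm))
    · exact hd' k hk h2.symm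
  · exact hd' g hg h1.symm

/-- The ends of a deleted edge are joined by the remaining boundary of the merged face. -/
theorem reachable_mergedEdges_erase (hG : G.Connected) {A : Finset M.IntFace}
    (hA : (M.weakDual.induce (A : Set M.IntFace)).IsTree) {ε : Sym2 V}
    (hε : ε ∈ M.mergedEdges A ∩ M.externalEdges) (d : G.Dart)
    (hd : d.edge ∈ M.partInternalEdges A ∨ d.edge = ε) :
    (SimpleGraph.fromEdgeSet ((M.mergedEdges A).erase ε : Set (Sym2 V))).Reachable
      d.fst d.snd := by
  rw [Finset.mem_inter] at hε
  obtain ⟨f₀, hf₀, hεf₀⟩ := M.mem_partEdges.1 (Finset.mem_sdiff.1 hε.1).1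
  rcases hd with hd | hd
  · obtain ⟨f, hf, g, hg, hfg, hef, heg⟩ := M.mem_partInternalEdges.1 hd
    have hadj : ∀ f g : M.IntFace, f ≠ g → ∀ e, e ∈ M.faceEdges f.1 → e ∈ M.faceEdges g.1 →
        M.weakDual.Adj f g := fun f g hfg e hef heg => ⟨hfg, Finset.card_eq_one.2 ⟨e, by
          ext e'
          rw [Finset.mem_inter, Finset.mem_singleton]
          exact ⟨fun h => M.eq_of_mem_faceEdges hG hfg hef heg h.1 h.2,
            fun h => h ▸ ⟨hef, heg⟩⟩⟩⟩
    -- The dual edge `fg` splits the tree; `Z` is the side without the face `f₀` of `ε`. Apart from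
    -- the edge of `d`, its boundary consists of merged edges, and `ε` is not among them.
    obtain ⟨Z, hZ₀, hZ, hZadj⟩ := exists_side_of_isTree hA.isAcyclic
      (f := ⟨f, hf⟩) (g := ⟨g, hg⟩) (hadj f g hfg _ hef heg) ⟨f₀, hf₀⟩
    have hZmem : ∀ k : M.IntFace, ∀ hk : k ∈ A,
        k.1 ∈ ((fun k : (A : Set M.IntFace) => k.1.1) '' Z) ↔ ⟨k, hk⟩ ∈ Z := fun k hk =>
      ⟨fun ⟨k', hk', h⟩ => by
        have : k' = ⟨k, hk⟩ := Subtype.ext (Subtype.ext h)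
        exact this ▸ hk', fun h => ⟨_, h, rfl⟩⟩
    refine M.reachable_of_boundary ((fun k : (A : Set M.IntFace) => k.1.1) '' Z) _ d ?_ ?_
    · have hfgd : ∀ f g : M.IntFace, ∀ (hf : f ∈ A) (hg : g ∈ A),
          ((⟨f, hf⟩ : (A : Set M.IntFace)) ∈ Z ↔ (⟨g, hg⟩ : (A : Set M.IntFace)) ∉ Z) →
          f.1 = M.faceOf d → g.1 = M.faceOf d.symm → (M.faceOf d ∈ ((fun k : (A : Set M.IntFace) =>
            k.1.1) '' Z) ↔ M.faceOf d.symm ∉ ((fun k : (A : Set M.IntFace) => k.1.1) '' Z)) := by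
        intro f g hf hg h h1 h2
        rw [← h1, ← h2, hZmem f hf, hZmem g hg, h]
      rcases M.edge_mem_faceEdges.1 hef with h1 | h1 <;>
        rcases M.edge_mem_faceEdges.1 heg with h2 | h2
      · exact (hfg (Subtype.ext (h1.trans h2.symm))).elim
      · exact hfgd f g hf hg hZ h1 h2
      · exact hfgd g f hg hf (by rw [hZ, not_not]) h2 h1
      · exact (hfg (Subtype.ext (h1.trans h2.symm))).elim
    · rintro d' ⟨⟨k, hk⟩, hkZ, hkd⟩ hd' hne
      have hk' : d'.edge ∈ M.faceEdges k.1 := M.edge_mem_faceEdges.2 (Or.inl hkd)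
      refine Finset.mem_erase.2 ⟨?_, M.edge_mem_mergedEdges hk hkd.symm fun l hl hld => ?_⟩
      · intro h
        rcases M.eq_or_eq_of_mem f₀.2 hεf₀ hε.2 (h ▸ hk') with h' | h'
        · have : k = f₀ := Subtype.ext h'
          subst this
          exact hZ₀ hkZ
        · exact k.2 h'
      · have hl' : d'.edge ∈ M.faceEdges l.1 := M.edge_mem_faceEdges.2 (Or.inr hld.symm)
        rw [hld, hZmem l hl] at hd'
        have hkl : k ≠ l := fun h => by subst h; exact hd' hkZ
        -- Two faces of `A` on different sides of the split can only be `f` and `g`, whose shared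
        -- edge is unique.
        refine hd' ((hZadj ⟨k, hk⟩ ⟨l, hl⟩ (hadj k l hkl _ hk' hl') fun h => ?_).1 hkZ)
        have h1 : d'.edge ∈ M.faceEdges f.1 ∧ d'.edge ∈ M.faceEdges g.1 := by
          rcases Sym2.eq_iff.1 h with ⟨h1, h2⟩ | ⟨h1, h2⟩
          · rw [Subtype.mk.injEq] at h1 h2
            exact ⟨h1 ▸ hk', h2 ▸ hl'⟩
          · rw [Subtype.mk.injEq] at h1 h2
            exact ⟨h2 ▸ hl', h1 ▸ hk'⟩
        exact hne (M.eq_of_mem_faceEdges hG hfg hef heg h1.1 h1.2)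
  -- For `ε` itself the whole part serves as the set of faces, with the exterior face across `ε`.
  · refine M.reachable_of_boundary {f | ∃ g ∈ A, g.1 = f} _ d ?_ ?_
    · have hext : M.ext ∉ {f : M.Face | ∃ g ∈ A, g.1 = f} := fun ⟨g, _, hg⟩ => g.2 hg
      have hmem : f₀.1 ∈ {f : M.Face | ∃ g ∈ A, g.1 = f} := ⟨f₀, hf₀, rfl⟩
      have h1 := hε.2
      rw [← hd] at h1 hεf₀
      rcases M.edge_mem_faceEdges.1 hεf₀ with h3 | h3 <;>
        rcases M.edge_mem_faceEdges.1 h1 with h2 | h2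
      · exact (f₀.2 (h3.trans h2.symm)).elim
      · rw [← h3, ← h2]
        exact iff_of_true hmem hext
      · rw [← h3, ← h2]
        exact iff_of_false hext (not_not_intro hmem)
      · exact (f₀.2 (h3.trans h2.symm)).elim
    · rintro d' ⟨k, hk, hkd⟩ hd' hne
      exact Finset.mem_erase.2 ⟨hd ▸ hne,
        M.edge_mem_mergedEdges hk hkd.symm fun l hl hld => hd' ⟨l, hl, hld.symm⟩⟩

variable (π : Finpartition (Finset.univ : Finset M.IntFace))

/-- The boundary of a merged face, without its selected edge, is not affected by the deletions. -/
theorem mem_deleteEdges_of_mem_mergedEdges (ε : Finset M.IntFace → Sym2 V)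
    (hε : ∀ A ∈ π.parts, ε A ∈ M.mergedEdges A ∩ M.externalEdges) {A : Finset M.IntFace}
    (hA : A ∈ π.parts) {e : Sym2 V} (he : e ∈ (M.mergedEdges A).erase (ε A)) :
    e ∈ ((G.deleteEdges {e | ∃ A ∈ π.parts, e ∈ M.partInternalEdges A}).deleteEdges
      {e | ∃ A ∈ π.parts, e = ε A}).edgeSet := by
  obtain ⟨hne, he⟩ := Finset.mem_erase.1 he
  obtain ⟨f, hf, hef⟩ := M.mem_partEdges.1 (Finset.mem_sdiff.1 he).1
  rw [SimpleGraph.edgeSet_deleteEdges, SimpleGraph.edgeSet_deleteEdges]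
  refine ⟨⟨M.mem_edgeSet_of_mem_faceEdges hef, ?_⟩, ?_⟩
  · rintro ⟨A', hA', h⟩
    obtain ⟨g, hg, k, hk, hgk, heg, hek⟩ := M.mem_partInternalEdges.1 h
    have hAA : A = A' := by
      rcases M.eq_or_eq_of_mem (fun h => hgk (Subtype.ext h)) heg hek hef with h | h
      · exact π.eq_of_mem_parts hA hA' hf (Subtype.ext h ▸ hg)
      · exact π.eq_of_mem_parts hA hA' hf (Subtype.ext h ▸ hk)
    exact (Finset.mem_sdiff.1 he).2 (hAA ▸ h)
  · rintro ⟨A', hA', rfl⟩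
    have h' := Finset.mem_inter.1 (hε A' hA')
    obtain ⟨g, hg, heg⟩ := M.mem_partEdges.1 (Finset.mem_sdiff.1 h'.1).1
    rcases M.eq_or_eq_of_mem g.2 heg h'.2 hef with h | h
    · exact hne (by rw [π.eq_of_mem_parts hA hA' hf (Subtype.ext h ▸ hg)])
    · exact f.2 h

/-- A graph obtained from `G` by the deletions that a tree `S`-partition of cost at most `t - 1`
prescribes is a tree `t`-spanner. -/
theorem isTreeSpanner_of_isObtainedFrom (hG : G.Connected) {T : SimpleGraph V} {t : ℕ}
    (hπ : IsTreeSPartition M.weakDual M.special π)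
    (ht : (partitionCost M.weight π : ℤ) ≤ (t : ℤ) - 1) (hT : IsObtainedFrom M π T) :
    IsTreeSpanner G T t := by
  classical
  obtain ⟨ε, hε, rfl⟩ := hT
  change ∀ A ∈ π.parts, ε A ∈ M.mergedEdges A ∩ M.externalEdges at hε
  set T := (G.deleteEdges {e | ∃ A ∈ π.parts, e ∈ M.partInternalEdges A}).deleteEdges
      {e | ∃ A ∈ π.parts, e = ε A} with hT
  have hTG : T ≤ G := (SimpleGraph.deleteEdges_le _).trans (SimpleGraph.deleteEdges_le _)
  have hstep : ∀ u v, G.Adj u v → ∃ p : T.Walk u v, p.length ≤ t := by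
    intro u v h
    by_cases hdel : ∃ A ∈ π.parts, s(u, v) ∈ M.partInternalEdges A ∨ s(u, v) = ε A
    · obtain ⟨A, hA, hd⟩ := hdel
      have hr := M.reachable_mergedEdges_erase hG (hπ A hA).1 (hε A hA) ⟨(u, v), h⟩ hd
      obtain ⟨p, hp⟩ := exists_walk_length_le_card hr
      have hle : SimpleGraph.fromEdgeSet (((M.mergedEdges A).erase (ε A) : Finset _) :
          Set (Sym2 V)) ≤ T := by
        intro a b hab
        rw [SimpleGraph.fromEdgeSet_adj] at hab
        exact M.mem_deleteEdges_of_mem_mergedEdges π ε hε hA (Finset.mem_coe.1 hab.1)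
      refine ⟨p.mapLe hle, ?_⟩
      rw [SimpleGraph.Walk.length_mapLe]
      have h1 := M.card_mergedEdges_le (hπ A hA).1
      have h2 : ∑ f ∈ A, M.weight f ≤ partitionCost M.weight π :=
        Finset.le_sup (f := fun A => ∑ x ∈ A, M.weight x) hA
      -- At most `w(A) + 2` boundary edges, less the selected one, leave `w(A) + 1 ≤ t`.
      rw [Finset.card_erase_of_mem (Finset.mem_inter.1 (hε A hA)).1] at hp
      omega
    · have hadj : T.Adj u v := by
        rw [hT, SimpleGraph.deleteEdges_adj, SimpleGraph.deleteEdges_adj]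
        exact ⟨⟨h, fun ⟨A, hA, h'⟩ => hdel ⟨A, hA, Or.inl h'⟩⟩,
          fun ⟨A, hA, h'⟩ => hdel ⟨A, hA, Or.inr h'⟩⟩
      -- The cost bound over the integers forces `t ≥ 1`.
      exact ⟨SimpleGraph.Walk.cons hadj .nil, by simp; omega⟩
  have hwalk : ∀ u v, ∀ p : G.Walk u v, ∃ q : T.Walk u v, q.length ≤ t * p.length := by
    intro u v p
    induction p with
    | nil => exact ⟨.nil, by simp⟩
    | cons h p ih =>
      obtain ⟨q, hq⟩ := ih
      obtain ⟨r, hr⟩ := hstep _ _ h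
      refine ⟨r.append q, ?_⟩
      rw [SimpleGraph.Walk.length_append, SimpleGraph.Walk.length_cons]
      nlinarith
  have hne := hG.nonempty
  refine ⟨hTG, ⟨⟨fun u v => ?_⟩, fun v c hc => ?_⟩, fun u v => ?_⟩
  · exact (hwalk u v (hG.preconnected u v).some).choose.reachable
  -- Deleted edges are not on the cycle, so `z` agrees across them: first along the tree of each
  -- part, then through the selected edge to the exterior face.
  · obtain ⟨z, hz₀, hz⟩ := M.exists_potential hG (c.mapLe hTG)
    have hdel : ∀ d : G.Dart, d.edge ∉ T.edgeSet → z (M.faceOf d) = z (M.faceOf d.symm) := by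
      intro d hd
      have := hz d
      rwa [SimpleGraph.Walk.edges_mapLe_eq_edges, List.count_eq_zero_of_not_mem
        fun h => hd (c.edges_subset_edgeSet h), Nat.cast_zero, CharTwo.add_eq_zero] at this
    have hdel' : ∀ f g : M.Face, f ≠ g → ∀ e, e ∈ M.faceEdges f → e ∈ M.faceEdges g →
        e ∉ T.edgeSet → z f = z g := by
      intro f g hfg e hf hg he
      obtain ⟨d, rfl, rfl, rfl⟩ := M.exists_dart_of_mem hfg hf hg
      exact hdel d he
    have hzero : ∀ f : M.Face, z f = 0 := by
      intro f
      by_cases hf : f = M.ext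
      · rw [hf, hz₀]
      obtain ⟨A, hA, hfA⟩ := π.exists_mem (Finset.mem_univ (⟨f, hf⟩ : M.IntFace))
      have h' := Finset.mem_inter.1 (hε A hA)
      obtain ⟨f₀, hf₀, hεf₀⟩ := M.mem_partEdges.1 (Finset.mem_sdiff.1 h'.1).1
      have h₀ : z f₀.1 = 0 := by
        rw [← hz₀]
        refine hdel' _ _ f₀.2 _ hεf₀ h'.2 fun h => ?_
        rw [hT, SimpleGraph.edgeSet_deleteEdges] at h
        exact h.2 ⟨A, hA, rfl⟩
      obtain ⟨p⟩ := (hπ A hA).1.connected.preconnected ⟨f₀, hf₀⟩ ⟨⟨f, hf⟩, hfA⟩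
      have hp : ∀ a b : (A : Set M.IntFace), (M.weakDual.induce (A : Set M.IntFace)).Walk a b →
          z a.1.1 = z b.1.1 := by
        intro a b p
        induction p with
        | nil => rfl
        | @cons a b _ h p ih =>
          rw [← ih]
          have hadj : M.weakDual.Adj a.1 b.1 := h
          obtain ⟨e, he⟩ := Finset.card_pos.1 (hadj.2.symm ▸ Nat.one_pos)
          rw [Finset.mem_inter] at he
          refine hdel' _ _ (fun h => hadj.1 (Subtype.ext h)) e he.1 he.2 fun h => ?_
          rw [hT, SimpleGraph.edgeSet_deleteEdges, SimpleGraph.edgeSet_deleteEdges] at h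
          exact h.1.2 ⟨A, hA, M.mem_partInternalEdges.2
            ⟨a.1, a.2, b.1, b.2, hadj.1, he.1, he.2⟩⟩
      exact (hp _ _ p).symm.trans h₀
    obtain ⟨e, he⟩ := List.exists_mem_of_ne_nil c.edges
      (fun h => hc.ne_nil (SimpleGraph.Walk.edges_eq_nil.1 h).eq_nil)
    obtain ⟨d, rfl⟩ : ∃ d : G.Dart, d.edge = e := by
      have := SimpleGraph.edgeSet_mono hTG (c.edges_subset_edgeSet he)
      induction e with | _ a b => exact ⟨⟨(a, b), this⟩, rfl⟩
    have := hz d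
    rw [hzero, hzero, SimpleGraph.Walk.edges_mapLe_eq_edges,
      List.count_eq_one_of_mem hc.isTrail.edges_nodup he] at this
    simp at this
  · obtain ⟨p, hp⟩ := (hG.preconnected u v).exists_walk_length_eq_dist
    obtain ⟨q, hq⟩ := hwalk u v p
    rw [← hp]
    exact (SimpleGraph.dist_le q).trans hq

end OuterplanarEmbedding

/-! ### Step-counted reasoning about programs. -/

section Runs

/-- From memory `s` the program `p` halts within `k` steps in a memory that satisfies `Q`. -/
def Runs (W : ℕ) (p : Prog) (s : Memory) (k : ℕ) (Q : Memory → Prop) : Prop :=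
  ∃ t s', Exec W p s t s' ∧ t ≤ k ∧ Q s'

variable {W : ℕ} {s : Memory} {k l : ℕ} {Q : Memory → Prop} {p q : Prog}

theorem Runs.mono {Q' : Memory → Prop} (h : Runs W p s k Q) (hk : k ≤ l) (hQ : ∀ s, Q s → Q' s) :
    Runs W p s l Q' := by
  obtain ⟨t, s', he, ht, hq⟩ := h
  exact ⟨t, s', he, ht.trans hk, hQ _ hq⟩

theorem Runs.weaken (h : Runs W p s k Q) (hk : k ≤ l) : Runs W p s l Q := h.mono hk fun _ h => h

theorem Runs.seq (h : Runs W p s k fun s' => Runs W q s' l Q) : Runs W (.seq p q) s (k + l) Q := by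
  obtain ⟨t, s', he, ht, t', s'', he', ht', hq⟩ := h
  exact ⟨_, _, .seq he he', add_le_add ht ht', hq⟩

theorem Runs.const {x v : ℕ} (hv : v ≤ W) (h : Q (s.setReg x v)) : Runs W (.const x v) s 1 Q :=
  ⟨_, _, .const s x v hv, le_rfl, h⟩

theorem Runs.add {x y z : ℕ} (hv : s.reg y + s.reg z ≤ W) (h : Q (s.setReg x (s.reg y + s.reg z))) :
    Runs W (.add x y z) s 1 Q :=
  ⟨_, _, .add s x y z hv, le_rfl, h⟩

theorem Runs.sub {x y z : ℕ} (h : Q (s.setReg x (s.reg y - s.reg z))) : Runs W (.sub x y z) s 1 Q :=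
  ⟨_, _, .sub s x y z, le_rfl, h⟩

theorem Runs.load {x a y : ℕ} (h : Q (s.setReg x (s.arr a (s.reg y)))) :
    Runs W (.load x a y) s 1 Q :=
  ⟨_, _, .load s x a y, le_rfl, h⟩

theorem Runs.store {a x y : ℕ} (h : Q (s.setArr a (s.reg x) (s.reg y))) :
    Runs W (.store a x y) s 1 Q :=
  ⟨_, _, .store s a x y, le_rfl, h⟩

theorem Runs.ifLt {x y : ℕ} (h : s.reg x < s.reg y → Runs W p s k Q)
    (h' : ¬ s.reg x < s.reg y → Runs W q s k Q) : Runs W (.ifLt x y p q) s (k + 1) Q := by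
  by_cases hx : s.reg x < s.reg y
  · obtain ⟨t, s', he, ht, hq⟩ := h hx
    exact ⟨_, _, .ifTrue hx he, by omega, hq⟩
  · obtain ⟨t, s', he, ht, hq⟩ := h' hx
    exact ⟨_, _, .ifFalse hx he, by omega, hq⟩

theorem Runs.whileFalse {x y : ℕ} (hx : ¬ s.reg x < s.reg y) (h : Q s) :
    Runs W (.whileLt x y p) s 1 Q :=
  ⟨_, _, .whileFalse hx, le_rfl, h⟩

theorem Runs.whileTrue {x y : ℕ} (hx : s.reg x < s.reg y)
    (h : Runs W p s k fun s' => Runs W (.whileLt x y p) s' l Q) :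
    Runs W (.whileLt x y p) s (k + l + 1) Q := by
  obtain ⟨t, s', he, ht, t', s'', he', ht', hq⟩ := h
  exact ⟨_, _, .whileTrue hx he he', by omega, hq⟩

@[simp] theorem Memory.reg_setReg (s : Memory) (x v y : ℕ) :
    (s.setReg x v).reg y = if y = x then v else s.reg y := Function.update_apply ..

@[simp] theorem Memory.arr_setReg (s : Memory) (x v : ℕ) : (s.setReg x v).arr = s.arr := rfl

@[simp] theorem Memory.reg_setArr (s : Memory) (a i v : ℕ) : (s.setArr a i v).reg = s.reg := rfl

@[simp] theorem Memory.arr_setArr (s : Memory) (a i v b : ℕ) :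
    (s.setArr a i v).arr b = if b = a then Function.update (s.arr a) i v else s.arr b :=
  Function.update_apply ..

end Runs

/-! ### Words in memory and the program. -/

/-- The array `I` holds the words `L` from position `p` on. -/
def Reads (I : ℕ → ℕ) (p : ℕ) (L : List ℕ) : Prop := ∀ j (h : j < L.length), I (p + j) = L[j]

theorem reads_nil (I : ℕ → ℕ) (p : ℕ) : Reads I p [] := fun _ h => (Nat.not_lt_zero _ h).elim

theorem reads_cons {I : ℕ → ℕ} {p a : ℕ} {L : List ℕ} :
    Reads I p (a :: L) ↔ I p = a ∧ Reads I (p + 1) L := by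
  constructor
  · intro h
    refine ⟨h 0 (by simp), fun j hj => ?_⟩
    have := h (j + 1) (by simpa using hj)
    rwa [List.getElem_cons_succ, ← Nat.add_assoc, Nat.add_right_comm] at this
  · rintro ⟨h1, h2⟩ j hj
    cases j with
    | zero => exact h1
    | succ j =>
      rw [List.getElem_cons_succ, ← h2 j (by simpa using hj), Nat.add_assoc, Nat.add_comm 1]

theorem reads_append {I : ℕ → ℕ} {p : ℕ} {L L' : List ℕ} :
    Reads I p (L ++ L') ↔ Reads I p L ∧ Reads I (p + L.length) L' := by
  induction L generalizing p with
  | nil => simp [reads_nil]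
  | cons a L ih =>
    rw [List.cons_append, reads_cons, ih, reads_cons, and_assoc, List.length_cons,
      Nat.add_right_comm p, Nat.add_assoc p]

theorem Reads.update {I : ℕ → ℕ} {p i v : ℕ} {L : List ℕ} (h : Reads I p L)
    (hi : i < p ∨ p + L.length ≤ i) : Reads (Function.update I i v) p L := by
  intro j hj
  rw [Function.update_of_ne (by omega), h j hj]

/-- The effect of an occurrence of an edge in the part with label `i` on the pair consisting of the
last label and of the class of the edge. -/
def markOne (i : ℕ) (x : ℕ × ℕ) : ℕ × ℕ := if x.1 < i then (i, x.2 + 1) else (x.1, 0)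

/-- The effect of an occurrence of the edge `e` in the part with label `i` on the table. -/
def mark (i : ℕ) (st : ℕ → ℕ × ℕ) (e : ℕ) : ℕ → ℕ × ℕ := Function.update st e (markOne i (st e))

/-- The effect of the list of a face. -/
def markFace {m : ℕ} (i : ℕ) (st : ℕ → ℕ × ℕ) (face : List (Fin m)) : ℕ → ℕ × ℕ :=
  face.foldl (fun st e => mark i st e) st

/-- The effect of a list of parts, the first one of which has label `i + 1`. -/
def markParts {m : ℕ} : ℕ → (ℕ → ℕ × ℕ) → List (List (List (Fin m))) → ℕ → ℕ × ℕ
  | _, st, [] => st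
  | i, st, part :: ps => markParts (i + 1) (part.foldl (markFace (i + 1)) st) ps

/-- Needed for the word bound: a class is increased only when the stored label is below the current
one, so the new class is at most the current label. -/
theorem mark_snd_le_fst {st : ℕ → ℕ × ℕ} (h : ∀ e, (st e).2 ≤ (st e).1) (i e e' : ℕ) :
    (mark i st e e').2 ≤ (mark i st e e').1 := by
  by_cases he : e' = e
  · subst he
    rw [mark, Function.update_self, markOne]
    have := h e'
    split_ifs with hlt
    · simp only
      omega
    · exact Nat.zero_le _
  · rw [mark, Function.update_of_ne he]
    exact h e'

/-- Sequential composition of a list of programs. -/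
def Prog.block : List Prog → Prog
  | [] => .skip
  | [p] => p
  | p :: ps => .seq p (block ps)

/-- Processing of one occurrence of an edge. -/
def entryProg : Prog := .block [
  -- Registers 0, 1, 2 hold these constants; 3 is the input pointer, 5 the label, and 4, 7, 9 count
  -- the remaining parts, faces and entries. Arrays 2 and 3 hold the label and class of each edge.
  .load 11 0 3, .add 3 3 1, .load 12 2 11,
  .ifLt 12 5 (.block [.load 13 3 11, .add 13 13 1, .store 2 11 5, .store 3 11 13]) (.store 3 11 0),
  .sub 9 9 1]

/-- Processing of one face. -/
def faceProg : Prog := .block [.load 9 0 3, .add 3 3 1, .whileLt 0 9 entryProg, .sub 7 7 1]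

/-- Processing of one part. -/
def partProg : Prog :=
  .block [.add 5 5 1, .load 7 0 3, .add 3 3 1, .whileLt 0 7 faceProg, .sub 4 4 1]

/-- Decision about one edge, which is deleted or written to the output. -/
def edgeProg : Prog := .block [
  .load 19 0 3, .add 3 3 1, .load 20 0 3, .add 3 3 1, .load 13 3 16, .load 12 2 16, .load 21 4 12,
  .add 21 21 13,
  -- Register 21 is flag plus class. Below 2 the edge is dropped and the sum is the new flag: class
  -- 0 leaves it as it was, a first class 1 sets it.
  .ifLt 21 2 (.store 4 12 21)
    (.block [.store 1 17 19, .add 17 17 1, .store 1 17 20, .add 17 17 1, .add 18 18 1]),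
  .add 16 16 1]

/-- The whole program. -/
def spannerProg : Prog := .block [
  -- The partition starts at word `2m + 2`, computed by doubling. The first two output cells are
  -- reserved and filled at the end.
  .const 1 1, .const 2 2, .load 14 0 0, .load 15 0 1, .add 3 15 15, .add 3 3 2, .load 4 0 3,
  .add 3 3 1, .whileLt 0 4 partProg, .add 3 0 2, .add 17 0 2, .whileLt 16 15 edgeProg,
  .store 1 0 14, .store 1 1 18]

/-- The memory while the list of parts is read: the pointer is `p`, the current label `i`. -/
structure MarkState (I : ℕ → ℕ) (n m p i : ℕ) (st : ℕ → ℕ × ℕ) (s : Memory) : Prop where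
  r0 : s.reg 0 = 0
  r1 : s.reg 1 = 1
  r2 : s.reg 2 = 2
  r3 : s.reg 3 = p
  r5 : s.reg 5 = i
  r14 : s.reg 14 = n
  r15 : s.reg 15 = m
  r16 : s.reg 16 = 0
  r18 : s.reg 18 = 0
  a0 : s.arr 0 = I
  a2 : s.arr 2 = fun e => (st e).1
  a3 : s.arr 3 = fun e => (st e).2
  a4 : s.arr 4 = fun _ => 0
  le : ∀ e, (st e).2 ≤ (st e).1

/-! ### Correctness and running time of the program. -/

section Machine

variable {W : ℕ} {I : ℕ → ℕ} {n m : ℕ}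

theorem entryProg_runs {s : Memory} {p i r : ℕ} {st : ℕ → ℕ × ℕ} (h : MarkState I n m p i st s)
    (hp : p + 1 ≤ W) (hi : i ≤ W) (hr : s.reg 9 = r + 1) :
    Runs W entryProg s 9 fun s' => MarkState I n m (p + 1) i (mark i st (I p)) s' ∧
      s'.reg 9 = r ∧ s'.reg 7 = s.reg 7 ∧ s'.reg 4 = s.reg 4 := by
  obtain ⟨h0, h1, h2, h3, h5, h14, h15, h16, h18, ha0, ha2, ha3, ha4, hst⟩ := h
  have hfst : ∀ e v, (fun e' => (Function.update st e v e').1)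
      = Function.update (fun e' => (st e').1) e v.1 := fun e v => by
    funext e'
    by_cases he : e' = e <;> simp [he]
  have hsnd : ∀ e v, (fun e' => (Function.update st e v e').2)
      = Function.update (fun e' => (st e').2) e v.2 := fun e v => by
    funext e'
    by_cases he : e' = e <;> simp [he]
  refine .seq (.load (.seq (.add ?_ (.seq (.load (.seq (k := 5) (l := 1) ?_))))))
  · simpa [h1, h3] using hp
  refine .ifLt (fun hlt => ?_) (fun hlt => ?_)
  · simp [h1, h3, h5, ha0, ha2] at hlt
    refine .seq (.load (.seq (.add ?_ (.seq (.store (.store (.sub ?_)))))))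
    · have := hst (I p)
      simp [h1, h3, ha0, ha3]
      omega
    · constructor
      · constructor
        case le => exact mark_snd_le_fst hst _ _
        all_goals simp [mark, markOne, *]
      · simp [hr, h1]
  · simp [h1, h3, h5, ha0, ha2] at hlt
    refine .weaken (k := 1) (.store (.sub ?_)) (by norm_num)
    constructor
    · constructor
      case le => exact mark_snd_le_fst hst _ _
      all_goals simp [mark, markOne, Nat.not_lt.2 hlt, *]
    · simp [hr, h1]

theorem faceLoop_runs {k i : ℕ} (hi : i ≤ W) (face : List (Fin k)) : ∀ {s : Memory} {p : ℕ}
    {st : ℕ → ℕ × ℕ}, MarkState I n m p i st s → Reads I p (face.map Fin.val) →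
    p + face.length ≤ W → s.reg 9 = face.length →
    Runs W (.whileLt 0 9 entryProg) s (10 * face.length + 1) fun s' =>
      MarkState I n m (p + face.length) i (markFace i st face) s' ∧
        s'.reg 7 = s.reg 7 ∧ s'.reg 4 = s.reg 4 := by
  induction face with
  | nil =>
    intro s p st h _ _ h9
    exact .whileFalse (by simp [h9]) ⟨h, rfl, rfl⟩
  | cons e face ih =>
    intro s p st h hI hp h9
    rw [List.map_cons, reads_cons] at hI
    rw [List.length_cons] at hp h9
    refine .weaken (.whileTrue (k := 9) (l := 10 * face.length + 1) (by rw [h.r0, h9]; omega) ?_)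
      (by rw [List.length_cons]; omega)
    refine (entryProg_runs h (by omega) hi h9).mono le_rfl fun s' ⟨h', h9', h7', h4'⟩ => ?_
    refine (ih h' hI.2 (by omega) h9').mono le_rfl fun s'' ⟨h'', h7'', h4''⟩ => ?_
    rw [hI.1, Nat.add_assoc, Nat.add_comm 1] at h''
    exact ⟨h'', h7''.trans h7', h4''.trans h4'⟩

/-- The words that describe the faces of a part. -/
def partWords {k : ℕ} (part : List (List (Fin k))) : List ℕ :=
  part.flatMap fun face => face.length :: face.map Fin.val

/-- Sixteen steps are charged to each word: a face with `k` edges uses `k + 1` words and at most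
`10k + 5` steps. -/
theorem partLoop_runs {k i : ℕ} (hi : i ≤ W) (part : List (List (Fin k))) : ∀ {s : Memory} {p : ℕ}
    {st : ℕ → ℕ × ℕ}, MarkState I n m p i st s → Reads I p (partWords part) →
    p + (partWords part).length ≤ W → s.reg 7 = part.length →
    Runs W (.whileLt 0 7 faceProg) s (16 * (partWords part).length + 1) fun s' =>
      MarkState I n m (p + (partWords part).length) i (part.foldl (markFace i) st) s' ∧
        s'.reg 4 = s.reg 4 := by
  induction part with
  | nil =>
    intro s p st h _ _ h7
    exact .whileFalse (by simp [h7]) ⟨h, rfl⟩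
  | cons face part ih =>
    intro s p st h hI hp h7
    have hw : partWords (face :: part) = (face.length :: face.map Fin.val) ++ partWords part := by
      simp [partWords]
    have hlen : (partWords (face :: part)).length = face.length + 1 + (partWords part).length := by
      simp [hw, Nat.add_right_comm]
    rw [hw, reads_append, reads_cons] at hI
    obtain ⟨⟨hI1, hI2⟩, hI3⟩ := hI
    rw [List.length_cons, List.length_map] at hI3
    rw [List.length_cons] at h7
    refine .weaken (.whileTrue (k := 1 + (1 + (10 * face.length + 1 + 1)))
      (l := 16 * (partWords part).length + 1) (by rw [h.r0, h7]; omega) ?_) (by omega)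
    refine .seq (.load (.seq (.add ?_ (.seq ?_))))
    · simp [h.r3, h.r1]
      omega
    have h' : MarkState I n m (p + 1) i st ((s.setReg 9 (s.arr 0 (s.reg 3))).setReg 3 (p + 1)) := by
      obtain ⟨h0, h1, h2, h3, h5, h14, h15, h16, h18, ha0, ha2, ha3, ha4, hst⟩ := h
      constructor
      case le => exact hst
      all_goals simp [*]
    have e1 : (s.setReg 9 (s.arr 0 (s.reg 3))).reg 3 + (s.setReg 9 (s.arr 0 (s.reg 3))).reg 1
      = p + 1 := by simp [h.r3, h.r1]
    rw [e1]
    refine (faceLoop_runs hi face h' hI2 (by omega) (by simp [h.a0, h.r3, hI1])).mono le_rfl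
      fun s' ⟨h', h7', h4'⟩ => .sub ?_
    have h'' : MarkState I n m (p + (face.length + 1)) i (markFace i st face)
        (s'.setReg 7 (s'.reg 7 - s'.reg 1)) := by
      rw [Nat.add_comm face.length, ← Nat.add_assoc]
      obtain ⟨h0, h1, h2, h3, h5, h14, h15, h16, h18, ha0, ha2, ha3, ha4, hst⟩ := h'
      constructor
      case le => exact hst
      all_goals simp [*]
    refine (ih h'' hI3 (by omega) (by simp [h7', h7, h'.r1])).mono le_rfl
      fun s'' ⟨h'', h4''⟩ => ⟨?_, ?_⟩
    · rw [Nat.add_assoc, ← hlen] at h''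
      exact h''
    · rw [h4'']
      simpa using h4'

/-- The words that describe a list of parts. -/
def partsWords {k : ℕ} (ps : List (List (List (Fin k)))) : List ℕ :=
  ps.flatMap fun part => part.length :: partWords part

/-- Each part contributes a word, so the number of words also bounds the labels. The final pointer
and label are not needed later. -/
theorem partsLoop_runs {k : ℕ} (ps : List (List (List (Fin k)))) : ∀ {s : Memory} {p i : ℕ}
    {st : ℕ → ℕ × ℕ}, MarkState I n m p i st s → Reads I p (partsWords ps) →
    p + (partsWords ps).length ≤ W → i + (partsWords ps).length ≤ W → s.reg 4 = ps.length →
    Runs W (.whileLt 0 4 partProg) s (16 * (partsWords ps).length + 1) fun s' =>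
      ∃ p' i', MarkState I n m p' i' (markParts i st ps) s' := by
  induction ps with
  | nil =>
    intro s p i st h _ _ _ h4
    exact .whileFalse (by simp [h4]) ⟨p, i, h⟩
  | cons part ps ih =>
    intro s p i st h hI hp hi h4
    have hw : partsWords (part :: ps) = (part.length :: partWords part) ++ partsWords ps := by
      simp [partsWords]
    have hlen : (partsWords (part :: ps)).length
        = (partWords part).length + 1 + (partsWords ps).length := by
      simp [hw, Nat.add_right_comm]
    rw [hw, reads_append, reads_cons, List.length_cons] at hI
    obtain ⟨⟨hI1, hI2⟩, hI3⟩ := hI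
    rw [List.length_cons] at h4
    refine .weaken (.whileTrue (k := 1 + (1 + (1 + (16 * (partWords part).length + 1 + 1))))
      (l := 16 * (partsWords ps).length + 1) (by rw [h.r0, h4]; omega) ?_) (by omega)
    refine .seq (.add ?_ (.seq (.load (.seq (.add ?_ (.seq ?_))))))
    · simp only [h.r5, h.r1]
      omega
    · simp [h.r3, h.r1]
      omega
    have e1 : s.reg 5 + s.reg 1 = i + 1 := by rw [h.r5, h.r1]
    rw [e1]
    set s₁ := (s.setReg 5 (i + 1)).setReg 7 ((s.setReg 5 (i + 1)).arr 0 ((s.setReg 5 (i + 1)).reg 3))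
      with hs₁
    have e2 : s₁.reg 3 + s₁.reg 1 = p + 1 := by simp [hs₁, h.r3, h.r1]
    rw [e2]
    have h' : MarkState I n m (p + 1) (i + 1) st (s₁.setReg 3 (p + 1)) := by
      obtain ⟨h0, h1, h2, h3, h5, h14, h15, h16, h18, ha0, ha2, ha3, ha4, hst⟩ := h
      constructor
      case le => exact hst
      all_goals simp [*]
    refine (partLoop_runs (by omega) part h' hI2 (by omega)
      (by simp [hs₁, h.a0, h.r3, hI1])).mono le_rfl fun s' ⟨h', h4'⟩ => .sub ?_
    have h'' : MarkState I n m (p + ((partWords part).length + 1)) (i + 1)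
        (part.foldl (markFace (i + 1)) st) (s'.setReg 4 (s'.reg 4 - s'.reg 1)) := by
      rw [Nat.add_comm (partWords part).length, ← Nat.add_assoc]
      obtain ⟨h0, h1, h2, h3, h5, h14, h15, h16, h18, ha0, ha2, ha3, ha4, hst⟩ := h'
      constructor
      case le => exact hst
      all_goals simp [*]
    exact ih h'' hI3 (by omega) (by omega) (by simp [h4', hs₁, h4, h'.r1])

/-- Whether one of the first `j` edges is an external edge of the part with label `l`. -/
def foundAt (st : ℕ → ℕ × ℕ) (j l : ℕ) : ℕ := if ∃ i < j, (st i).2 = 1 ∧ (st i).1 = l then 1 else 0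

/-- Whether the `j`-th edge is kept. -/
def isKept (st : ℕ → ℕ × ℕ) (j : ℕ) : Bool := 2 ≤ foundAt st j (st j).1 + (st j).2

/-- The positions of the kept edges among the first `j` edges. -/
def keptUpTo (st : ℕ → ℕ × ℕ) (j : ℕ) : List ℕ := (List.range j).filter (isKept st)

/-- The end vertices of the kept edges among the first `j` edges. -/
def keptWords (I : ℕ → ℕ) (st : ℕ → ℕ × ℕ) (j : ℕ) : List ℕ :=
  (keptUpTo st j).flatMap fun i => [I (2 + 2 * i), I (2 + 2 * i + 1)]

theorem foundAt_le_one (st : ℕ → ℕ × ℕ) (j l : ℕ) : foundAt st j l ≤ 1 := by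
  unfold foundAt
  split_ifs <;> simp

theorem foundAt_eq_one {st : ℕ → ℕ × ℕ} {j l : ℕ} :
    foundAt st j l = 1 ↔ ∃ i < j, (st i).2 = 1 ∧ (st i).1 = l := by
  simp [foundAt]

theorem isKept_iff {st : ℕ → ℕ × ℕ} {j : ℕ} :
    isKept st j = true ↔ 2 ≤ foundAt st j (st j).1 + (st j).2 := by
  simp [isKept]

/-- This justifies the single store into the flag array: a kept edge never changes the flag of its
label, and for a dropped one the new flag is the sum just tested. -/
theorem foundAt_succ (st : ℕ → ℕ × ℕ) {j : ℕ} (hj : (st j).2 ≤ 2) : foundAt st (j + 1) =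
    if isKept st j then foundAt st j
    else Function.update (foundAt st j) (st j).1 (foundAt st j (st j).1 + (st j).2) := by
  have hsucc : ∀ l, foundAt st (j + 1) l = 1 ↔ foundAt st j l = 1 ∨ (st j).2 = 1 ∧ (st j).1 = l := by
    intro l
    simp only [foundAt_eq_one, Nat.lt_succ_iff_lt_or_eq, or_and_right, exists_or, exists_eq_left]
  funext l
  have h1 := hsucc l
  have h2 := foundAt_le_one st (j + 1) l
  have h3 := foundAt_le_one st j l
  have h4 := foundAt_le_one st j (st j).1
  have h6 := isKept_iff (st := st) (j := j)
  by_cases hl : l = (st j).1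
  · subst hl
    split_ifs with hk
    · have := h6.1 hk
      omega
    · have := mt h6.2 hk
      rw [Function.update_self]
      omega
  · have h5 : ¬ ((st j).2 = 1 ∧ (st j).1 = l) := fun h => hl h.2.symm
    split_ifs with hk
    · omega
    · rw [Function.update_of_ne hl]
      omega

theorem keptUpTo_succ (st : ℕ → ℕ × ℕ) (j : ℕ) :
    keptUpTo st (j + 1) = keptUpTo st j ++ if isKept st j then [j] else [] := by
  rw [keptUpTo, List.range_succ, List.filter_append, ← keptUpTo]
  congr 1
  by_cases h : isKept st j = true <;> simp [h]

theorem keptWords_succ (I : ℕ → ℕ) (st : ℕ → ℕ × ℕ) (j : ℕ) : keptWords I st (j + 1)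
    = keptWords I st j ++ if isKept st j then [I (2 + 2 * j), I (2 + 2 * j + 1)] else [] := by
  rw [keptWords, keptUpTo_succ, List.flatMap_append, ← keptWords]
  congr 1
  by_cases h : isKept st j = true <;> simp [h]

theorem length_keptUpTo_le (st : ℕ → ℕ × ℕ) (j : ℕ) : (keptUpTo st j).length ≤ j :=
  (List.length_filter_le _ _).trans_eq (List.length_range)

theorem length_keptWords (I : ℕ → ℕ) (st : ℕ → ℕ × ℕ) (j : ℕ) :
    (keptWords I st j).length = 2 * (keptUpTo st j).length := by
  simp [keptWords, List.length_flatMap, Nat.mul_comm]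

/-- The memory after the decision about the first `j` edges. -/
structure EdgeState (I : ℕ → ℕ) (n m : ℕ) (st : ℕ → ℕ × ℕ) (j : ℕ) (s : Memory) : Prop where
  r0 : s.reg 0 = 0
  r1 : s.reg 1 = 1
  r2 : s.reg 2 = 2
  r3 : s.reg 3 = 2 + 2 * j
  r14 : s.reg 14 = n
  r15 : s.reg 15 = m
  r16 : s.reg 16 = j
  r17 : s.reg 17 = 2 + (keptWords I st j).length
  r18 : s.reg 18 = (keptUpTo st j).length
  a0 : s.arr 0 = I
  a2 : s.arr 2 = fun e => (st e).1
  a3 : s.arr 3 = fun e => (st e).2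
  a4 : s.arr 4 = foundAt st j
  out : Reads (s.arr 1) 2 (keptWords I st j)

theorem edgeProg_runs {s : Memory} {j : ℕ} {st : ℕ → ℕ × ℕ} (h : EdgeState I n m st j s)
    (hj : (st j).2 ≤ 2) (hW : 2 + 2 * (j + 1) ≤ W) :
    Runs W edgeProg s 15 (EdgeState I n m st (j + 1)) := by
  obtain ⟨h0, h1, h2, h3, h14, h15, h16, h17, h18, ha0, ha2, ha3, ha4, hout⟩ := h
  have hk := length_keptUpTo_le st j
  have hl := length_keptWords I st j
  have hf := foundAt_le_one st j (st j).1
  have hsucc := foundAt_succ st hj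
  have hkept := keptUpTo_succ st j
  have hwords := keptWords_succ I st j
  -- The loads before the test are abstracted into what they leave in the registers.
  suffices key : ∀ s₁ : Memory, s₁.arr = s.arr → s₁.reg 0 = 0 → s₁.reg 1 = 1 → s₁.reg 2 = 2 →
      s₁.reg 3 = 2 + 2 * (j + 1) → s₁.reg 14 = n → s₁.reg 15 = m → s₁.reg 16 = j →
      s₁.reg 17 = 2 + (keptWords I st j).length → s₁.reg 18 = (keptUpTo st j).length →
      s₁.reg 19 = I (2 + 2 * j) → s₁.reg 20 = I (2 + 2 * j + 1) → s₁.reg 12 = (st j).1 →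
      s₁.reg 21 = foundAt st j (st j).1 + (st j).2 →
      Runs W (.ifLt 21 2 (.store 4 12 21) (.block [.store 1 17 19, .add 17 17 1, .store 1 17 20,
        .add 17 17 1, .add 18 18 1])) s₁ 6 fun s' =>
          Runs W (.add 16 16 1) s' 1 (EdgeState I n m st (j + 1)) by
    refine .seq (.load (.seq (.add ?_ (.seq (.load (.seq (.add ?_ (.seq (.load (.seq (.load
      (.seq (.load (.seq (.add ?_ (.seq (k := 6) (l := 1) (key _ ?_ ?_ ?_ ?_ ?_ ?_ ?_ ?_ ?_ ?_ ?_ ?_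
        ?_ ?_)))))))))))))))))
    · simp [h1, h3]
      omega
    · simp [h1, h3]
      omega
    · simp [h1, h3, h16, ha2, ha3, ha4]
      omega
    case refine_8 => simp [h1, h3]; omega
    all_goals simp [h0, h1, h2, h3, h14, h15, h16, h17, h18, ha0, ha2, ha3, ha4]
  clear h0 h1 h2 h3 h14 h15 h16 h17 h18
  intro s₁ harr h0 h1 h2 h3 h14 h15 h16 h17 h18 h19 h20 h12 h21
  rw [← harr] at ha0 ha2 ha3 ha4 hout
  refine .ifLt (fun hlt => ?_) (fun hlt => ?_)
  · rw [h21, h2] at hlt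
    have hno : isKept st j = false := by
      rw [← Bool.not_eq_true, isKept_iff]
      omega
    simp [hno] at hsucc hkept hwords
    refine .weaken (k := 1) (.store (.add ?_ ?_)) (by norm_num)
    · simp only [Memory.reg_setArr, h16, h1]
      omega
    · constructor
      case out => simpa [hwords] using hout
      all_goals simp [*]
  · rw [h21, h2] at hlt
    simp [isKept_iff.2 (Nat.le_of_not_lt hlt)] at hsucc hkept hwords
    set q := 2 + (keptWords I st j).length with hq
    have hq1 : q + 1 + 1 ≤ W := by omega
    refine .seq (.store (.seq (.add ?_ (.seq (.store (.seq (.add ?_ (.add ?_ (.add ?_ ?_)))))))))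
    · simp [h1, h17]
      omega
    · simpa [h1, h17] using hq1
    · simp [h1, h18]
      omega
    · simp [h1, h16]
      omega
    · constructor
      case r17 => simp [h1, h17, hwords]; omega
      case out =>
        rw [hwords, reads_append, reads_cons, reads_cons]
        refine ⟨?_, ?_, ?_, reads_nil _ _⟩
        · simp [h1, h17]
          exact (hout.update (by omega)).update (by omega)
        · simp [h1, h17, h19, ← hq]
        · simp [h1, h17, h20, ← hq]
      all_goals simp [h0, h1, h2, h3, h14, h15, h16, h18, ha0, ha2, ha3, ha4, hkept, hsucc]

theorem edgeLoop_runs {st : ℕ → ℕ × ℕ} (hst : ∀ j < m, (st j).2 ≤ 2) (hW : 2 + 2 * m ≤ W) (r : ℕ) :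
    ∀ {s : Memory} {j : ℕ}, EdgeState I n m st j s → j + r = m →
    Runs W (.whileLt 16 15 edgeProg) s (16 * r + 1) (EdgeState I n m st m) := by
  induction r with
  | zero =>
    intro s j h hj
    obtain rfl : j = m := hj
    exact .whileFalse (by rw [h.r16, h.r15]; omega) h
  | succ r ih =>
    intro s j h hj
    refine .weaken (.whileTrue (k := 15) (l := 16 * r + 1) (by rw [h.r16, h.r15]; omega) ?_)
      (by omega)
    exact (edgeProg_runs h (hst j (by omega)) (by omega)).mono le_rfl fun s' h' => ih h' (by omega)

theorem reads_flatMap {es : List (Fin n × Fin n)} : ∀ {p : ℕ},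
    Reads I p (es.flatMap fun e => [e.1.val, e.2.val]) → ∀ j (hj : j < es.length),
      I (p + 2 * j) = es[j].1.val ∧ I (p + 2 * j + 1) = es[j].2.val := by
  induction es with
  | nil => exact fun _ j hj => (Nat.not_lt_zero _ hj).elim
  | cons e es ih =>
    intro p h j hj
    rw [List.flatMap_cons, reads_append, reads_cons, reads_cons] at h
    obtain ⟨⟨h1, h2, -⟩, h3⟩ := h
    cases j with
    | zero => exact ⟨h1, h2⟩
    | succ j =>
      rw [show p + 2 * (j + 1) = p + 2 + 2 * j by omega]
      exact ih h3 j (by simpa using hj)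

/-- What the program computes. -/
theorem spannerProg_runs {es : List (Fin n × Fin n)} {ps : List (List (List (Fin es.length)))}
    (hst : ∀ j < es.length, (markParts 0 (fun _ => (0, 0)) ps j).2 ≤ 2)
    (hW : 2 * es.length + 3 + (partsWords ps).length ≤ W) :
    Runs W spannerProg (initialMemory (graphWords es ++ partitionWords ps))
      (16 * (partsWords ps).length + 16 * es.length + 14) fun s =>
        HasOutput s (graphWords (((List.finRange es.length).filter fun j =>
          isKept (markParts 0 (fun _ => (0, 0)) ps) j.1).map es.get)) := by
  obtain ⟨I, hI⟩ : ∃ I : ℕ → ℕ, I = fun i => (graphWords es ++ partitionWords ps).getD i 0 := ⟨_, rfl⟩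
  have hreads : Reads I 0 (graphWords es ++ partitionWords ps) := fun j hj => by
    simp [hI, List.getElem?_eq_getElem hj]
  have hreg : (initialMemory (graphWords es ++ partitionWords ps)).reg = fun _ => 0 := rfl
  have harr : (initialMemory (graphWords es ++ partitionWords ps)).arr
    = fun a i => if a = 0 then I i else 0 := by rw [hI]; rfl
  generalize initialMemory (graphWords es ++ partitionWords ps) = s₀ at hreg harr ⊢
  have hglen : (graphWords es).length = 2 + 2 * es.length := by
    simp [graphWords, List.length_flatMap]
    omega
  rw [reads_append, hglen] at hreads
  obtain ⟨hr1, hr2⟩ := hreads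
  rw [graphWords, reads_cons, reads_cons] at hr1
  rw [partitionWords, reads_cons] at hr2
  obtain ⟨hI0, hI1, hI2⟩ := hr1
  obtain ⟨hI3, hI4⟩ := hr2
  simp only [Nat.zero_add] at hI0 hI1 hI2 hI3 hI4
  have hedge := reads_flatMap hI2
  have hlen := length_keptUpTo_le (markParts 0 (fun _ => (0, 0)) ps) es.length
  -- The graph takes `2 + 2m` words and the number of parts one more, so the first part begins at
  -- `2m + 3`.
  suffices key : ∀ s : Memory, MarkState I n es.length (2 + 2 * es.length + 1) 0
      (fun _ => (0, 0)) s → s.reg 4 = ps.length → Runs W (.whileLt 0 4 partProg) s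
        (16 * (partsWords ps).length + 1) fun s => Runs W (.block [.add 3 0 2, .add 17 0 2,
          .whileLt 16 15 edgeProg, .store 1 0 14, .store 1 1 18]) s (16 * es.length + 5)
            fun s => HasOutput s (graphWords (((List.finRange es.length).filter fun j =>
              isKept (markParts 0 (fun _ => (0, 0)) ps) j.1).map es.get)) by
    refine .weaken (.seq (.const (by omega) (.seq (.const (by omega) (.seq (.load (.seq (.load
      (.seq (.add ?_ (.seq (.add ?_ (.seq (.load (.seq (.add ?_
      (.seq (k := 16 * (partsWords ps).length + 1) (l := 16 * es.length + 5)
        (key _ ?_ ?_)))))))))))))))))) (by omega)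
    · simp [hreg, harr, hI1]
      omega
    · simp [hreg, harr, hI1]
      omega
    · simp [hreg, harr, hI1]
      omega
    · constructor
      case r3 => simp [hreg, harr, hI1]; omega
      all_goals simp [hreg, harr, hI0, hI1]
    · simp [hreg, harr, hI1, ← hI3, Nat.two_mul, Nat.add_comm]
  intro s h h4
  refine (partsLoop_runs ps h hI4 (by omega) (by omega) h4).mono le_rfl fun s ⟨p, i, h⟩ => ?_
  refine .weaken (.seq (.add ?_ (.seq (.add ?_ (.seq (k := 16 * es.length + 1) (l := 2) ?_)))))
    (by omega)
  · simp [h.r0, h.r2]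
    omega
  · simp [h.r0, h.r2]
    omega
  refine (edgeLoop_runs (I := I) (n := n) (j := 0) hst (by omega) es.length ?_ (by omega)).mono le_rfl fun s h => ?_
  · obtain ⟨h0, h1, h2, h3, h5, h14, h15, h16, h18, ha0, ha2, ha3, ha4, -⟩ := h
    constructor
    case a4 => ext; simp [ha4, foundAt]
    case out => exact reads_nil _ _
    all_goals simp [h0, h1, h2, h14, h15, h16, h18, ha0, ha2, ha3, keptWords, keptUpTo]
  · refine .seq (.store (.store ?_))
    set kept := (List.finRange es.length).filter fun j =>
      isKept (markParts 0 (fun _ => (0, 0)) ps) j.1 with hkept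
    have hmap : keptUpTo (markParts 0 (fun _ => (0, 0)) ps) es.length = kept.map Fin.val := by
      rw [keptUpTo, ← List.map_coe_finRange_eq_range, List.filter_map]
      rfl
    have hwords : keptWords I (markParts 0 (fun _ => (0, 0)) ps) es.length
        = (kept.map es.get).flatMap fun e => [e.1.val, e.2.val] := by
      rw [keptWords, hmap, List.flatMap_map, List.flatMap_map]
      congr 1
      funext j
      rw [(hedge j.1 j.2).1, (hedge j.1 j.2).2]
      rfl
    have hread : Reads ((((s.setArr 1 (s.reg 0) (s.reg 14))).setArr 1
        ((s.setArr 1 (s.reg 0) (s.reg 14)).reg 1) ((s.setArr 1 (s.reg 0) (s.reg 14)).reg 18)).arr 1)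
        0 (graphWords (kept.map es.get)) := by
      rw [graphWords, reads_cons, reads_cons, ← hwords]
      refine ⟨by simp [h.r0, h.r1, h.r14], ?_, ?_⟩
      · simp [h.r1, h.r18, hmap]
      · simp [h.r0, h.r1]
        exact (h.out.update (by omega)).update (by omega)
    intro j hj
    have := hread j hj
    rwa [Nat.zero_add] at this

end Machine

/-! ### Classification of edges by their occurrences. -/

theorem markFace_apply {m : ℕ} {i : ℕ} {st : ℕ → ℕ × ℕ} {c : List (Fin m)} (hc : c.Nodup)
    (j : Fin m) : markFace i st c j = if j ∈ c then markOne i (st j) else st j := by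
  induction c generalizing st with
  | nil => rfl
  | cons e c ih =>
    rw [List.nodup_cons] at hc
    change markFace i (mark i st e) c j = _
    rw [ih hc.2, mark]
    by_cases he : j = e
    · subst he
      simp [hc.1]
    · rw [Function.update_of_ne fun h => he (Fin.ext h)]
      simp [he]

/-- The members of the lists, each with the number of its list, counted from `i + 1` on. -/
def labelled {X : Type*} : ℕ → List (List X) → List (ℕ × X)
  | _, [] => []
  | i, l :: ls => l.map (Prod.mk (i + 1)) ++ labelled (i + 1) ls

theorem mem_labelled {X : Type*} {ls : List (List X)} : ∀ {i : ℕ} {y : ℕ × X},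
    y ∈ labelled i ls ↔ ∃ k, ∃ h : k < ls.length, y.1 = i + k + 1 ∧ y.2 ∈ ls[k] := by
  induction ls with
  | nil => simp [labelled]
  | cons l ls ih =>
    intro i y
    rw [labelled, List.mem_append, ih, List.mem_map]
    constructor
    · rintro (⟨x, hx, rfl⟩ | ⟨k, hk, h1, h2⟩)
      · exact ⟨0, by simp, rfl, hx⟩
      · exact ⟨k + 1, by simpa using hk, by omega, h2⟩
    · rintro ⟨k, hk, h1, h2⟩
      cases k with
      | zero => exact Or.inl ⟨y.2, h2, Prod.ext h1.symm rfl⟩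
      | succ k => exact Or.inr ⟨k, by simpa using hk, by omega, h2⟩

theorem map_snd_labelled {X : Type*} (ls : List (List X)) : ∀ i : ℕ,
    (labelled i ls).map Prod.snd = ls.flatten := by
  induction ls with
  | nil => exact fun _ => rfl
  | cons l ls ih =>
    intro i
    rw [labelled, List.map_append, ih, List.flatten_cons, List.map_map]
    congr 1
    exact List.map_id l

/-- With nondecreasing labels, a failed test `<` in `markOne` means that the label is repeated. -/
theorem pairwise_labelled {X : Type*} (ls : List (List X)) : ∀ i : ℕ,
    (labelled i ls).Pairwise fun y y' => y.1 ≤ y'.1 := by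
  induction ls with
  | nil => exact fun _ => List.Pairwise.nil
  | cons l ls ih =>
    intro i
    rw [labelled, List.pairwise_append]
    refine ⟨?_, ih _, ?_⟩
    · rw [List.pairwise_map]
      exact List.pairwise_of_forall fun _ _ => le_rfl
    · intro y hy y' hy'
      obtain ⟨x, -, rfl⟩ := List.mem_map.1 hy
      obtain ⟨k, -, h, -⟩ := mem_labelled.1 hy'
      change i + 1 ≤ _
      omega

section Classification

variable {X : Type*} {m : ℕ} {j : Fin m} {P : X → Prop} [DecidablePred P]

theorem foldl_markFace_apply {i : ℕ} {l : List X} {part : List (List (Fin m))}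
    (h : List.Forall₂ (fun f c => c.Nodup ∧ (j ∈ c ↔ P f)) l part) : ∀ st : ℕ → ℕ × ℕ,
    part.foldl (markFace i) st j = (l.filter P).foldl (fun x _ => markOne i x) (st j) := by
  induction h with
  | nil => exact fun _ => rfl
  | @cons f c l part hfc _ ih =>
    intro st
    rw [List.foldl_cons, ih, markFace_apply hfc.1]
    by_cases hf : P f
    · rw [if_pos (hfc.2.2 hf), List.filter_cons_of_pos (by simpa using hf), List.foldl_cons]
    · rw [if_neg (mt hfc.2.1 hf), List.filter_cons_of_neg (by simpa using hf)]

/-- Only faces containing the edge `j` touch its entry, each once. For a fixed edge the whole pass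
is thus a fold over the labelled faces that contain it. -/
theorem markParts_apply {ls : List (List X)} {ps : List (List (List (Fin m)))}
    (h : List.Forall₂ (List.Forall₂ fun f c => c.Nodup ∧ (j ∈ c ↔ P f)) ls ps) :
    ∀ (i : ℕ) (st : ℕ → ℕ × ℕ), markParts i st ps j
      = ((labelled i ls).filter fun y => P y.2).foldl (fun x y => markOne y.1 x) (st j) := by
  induction h with
  | nil => exact fun _ _ => rfl
  | @cons l part ls ps hl _ ih =>
    intro i st
    rw [markParts, ih, foldl_markFace_apply hl, labelled, List.filter_append, List.foldl_append,
      List.filter_map, List.foldl_map]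
    rfl

/-- An item that occurs exactly once has class one and the label of its occurrence. -/
theorem foldl_markOne_of_unique {L : List (ℕ × X)} (hL : (L.map Prod.snd).Nodup) {y : ℕ × X}
    (hy : y ∈ L) (hyu : ∀ y' ∈ L, y'.2 = y.2) (hpos : 0 < y.1) :
    L.foldl (fun x y => markOne y.1 x) (0, 0) = (y.1, 1) := by
  match L with
  | [] => simp at hy
  | [a] =>
    obtain rfl := List.mem_singleton.1 hy
    simp [markOne, hpos]
  | a :: b :: L =>
    have := (hyu a (by simp)).trans (hyu b (by simp)).symm
    simp [this] at hL

/-- An item that occurs exactly twice has class zero if the labels of the occurrences agree, and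
class two otherwise. -/
theorem foldl_markOne_of_pair {L : List (ℕ × X)} (hL : (L.map Prod.snd).Nodup)
    (hs : L.Pairwise fun y y' => y.1 ≤ y'.1) {y z : ℕ × X} (hy : y ∈ L) (hz : z ∈ L)
    (hne : y.2 ≠ z.2) (hyz : ∀ y' ∈ L, y'.2 = y.2 ∨ y'.2 = z.2) (hypos : 0 < y.1) (hzpos : 0 < z.1) :
    (L.foldl (fun x y => markOne y.1 x) (0, 0)).2 = if y.1 = z.1 then 0 else 2 := by
  match L with
  | [] => simp at hy
  | [a] =>
    rw [List.mem_singleton] at hy hz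
    exact (hne (by rw [hy, hz])).elim
  | [a, b] =>
    have hab : a.1 ≤ b.1 := by simpa using hs
    -- The first occurrence gives class 1 because labels are positive; the second resets it to 0 for
    -- the same label and raises it to 2 for a larger one.
    have key : ∀ a b : ℕ × X, 0 < a.1 → a.1 ≤ b.1 →
        ([a, b].foldl (fun x y => markOne y.1 x) (0, 0)).2 = if a.1 = b.1 then 0 else 2 := by
      intro a b ha hab
      by_cases h : a.1 = b.1
      · simp [markOne, h, h ▸ ha]
      · simp [markOne, ha, h, lt_of_le_of_ne hab h]
    simp only [List.mem_cons, List.not_mem_nil, or_false] at hy hz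
    rcases hy with rfl | rfl <;> rcases hz with rfl | rfl
    · exact (hne rfl).elim
    · exact key _ _ hypos hab
    · rw [key _ _ hzpos hab]
      simp only [eq_comm]
    · exact (hne rfl).elim
  -- Three distinct items cannot all be among two.
  | a :: b :: c :: L =>
    simp only [List.map_cons, List.nodup_cons, List.mem_cons, not_or] at hL
    rcases hyz a (by simp) with ha | ha <;> rcases hyz b (by simp) with hb | hb <;>
      rcases hyz c (by simp) with hc | hc <;> simp_all

end Classification

/-! ### Size and meaning of the input. -/

namespace OuterplanarEmbedding

variable {V : Type*} [Fintype V] {G : SimpleGraph V} (M : OuterplanarEmbedding G)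

theorem card_intFace_le (hG : IsTwoConnected G) : Fintype.card M.IntFace ≤ G.edgeSet.ncard := by
  classical
  have h1 : Nat.card V + Nat.card M.Face = G.edgeSet.ncard + 2 := M.euler
  have h2 := hG.three_le
  have h3 : Nat.card M.IntFace ≤ Nat.card M.Face := Nat.card_le_card_of_injective _
    Subtype.val_injective
  rw [Nat.card_eq_fintype_card] at h1 h3
  omega

variable [DecidableEq V]

/-- Double counting: an edge lies only on the faces of its two darts. -/
theorem sum_card_faceEdges_le : ∑ f : M.IntFace, (M.faceEdges f.1).card ≤ 2 * G.edgeSet.ncard := by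
  classical
  have h1 : ∑ f : M.IntFace, (M.faceEdges f.1).card
      = ∑ e ∈ G.edgeFinset, (Finset.univ.filter fun f : M.IntFace => e ∈ M.faceEdges f.1).card := by
    refine Eq.trans ?_ (Finset.sum_card_bipartiteAbove_eq_sum_card_bipartiteBelow
      (fun (f : M.IntFace) (e : Sym2 V) => e ∈ M.faceEdges f.1))
    refine Finset.sum_congr rfl fun f hf => congrArg Finset.card ?_
    ext e
    simp only [Finset.bipartiteAbove, Finset.mem_filter]
    exact ⟨fun h => ⟨SimpleGraph.mem_edgeFinset.2 (M.mem_edgeSet_of_mem_faceEdges h), h⟩, fun h => h.2⟩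
  rw [h1, ← SimpleGraph.coe_edgeFinset, Set.ncard_coe_finset, Nat.mul_comm, ← smul_eq_mul]
  refine Finset.sum_le_card_nsmul _ _ 2 fun e he => ?_
  rw [SimpleGraph.mem_edgeFinset] at he
  induction e with | _ u v =>
  rw [← Finset.card_map ⟨Subtype.val, Subtype.val_injective⟩]
  refine (Finset.card_le_card fun f hf => ?_).trans (Finset.card_le_two
    (a := M.faceOf ⟨(u, v), he⟩) (b := M.faceOf (SimpleGraph.Dart.symm ⟨(u, v), he⟩)))
  obtain ⟨f, hf', rfl⟩ := Finset.mem_map.1 hf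
  rw [Finset.mem_insert, Finset.mem_singleton]
  exact M.edge_mem_faceEdges.1 (Finset.mem_filter.1 hf').2

end OuterplanarEmbedding

/-- `fs` lists the parts of `π`, and for every part its elements, without repetitions. -/
structure IsPartList {X : Type*} [Fintype X] [DecidableEq X]
    (π : Finpartition (Finset.univ : Finset X)) (fs : List (List X)) : Prop where
  nodup : ∀ l ∈ fs, l.Nodup
  nodup_map : (fs.map List.toFinset).Nodup
  mem_iff : ∀ A, A ∈ fs.map List.toFinset ↔ A ∈ π.parts

namespace IsPartList

variable {X : Type*} [Fintype X] [DecidableEq X] {π : Finpartition (Finset.univ : Finset X)}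
  {fs : List (List X)}

theorem toFinset_mem (h : IsPartList π fs) {k : ℕ} (hk : k < fs.length) : fs[k].toFinset ∈ π.parts :=
  (h.mem_iff _).1 (List.mem_map.2 ⟨_, List.getElem_mem hk, rfl⟩)

theorem exists_index (h : IsPartList π fs) {A : Finset X} (hA : A ∈ π.parts) :
    ∃ k, ∃ hk : k < fs.length, fs[k].toFinset = A := by
  obtain ⟨l, hl, rfl⟩ := List.mem_map.1 ((h.mem_iff A).2 hA)
  obtain ⟨k, hk, rfl⟩ := List.getElem_of_mem hl
  exact ⟨k, hk, rfl⟩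

theorem index_unique (h : IsPartList π fs) {k k' : ℕ} {hk : k < fs.length} {hk' : k' < fs.length} {x : X}
    (hx : x ∈ fs[k]) (hx' : x ∈ fs[k']) : k = k' := by
  have := π.eq_of_mem_parts (h.toFinset_mem hk) (h.toFinset_mem hk') (List.mem_toFinset.2 hx)
    (List.mem_toFinset.2 hx')
  refine (h.nodup_map.getElem_inj_iff (hi := by simpa using hk) (hj := by simpa using hk')).1 ?_
  simpa using this

theorem nodup_flatten (h : IsPartList π fs) : fs.flatten.Nodup := by
  rw [List.nodup_flatten]
  refine ⟨h.nodup, List.pairwise_iff_getElem.2 fun i j hi hj hij x hx hx' => ?_⟩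
  exact hij.ne (h.index_unique hx hx')

theorem exists_mem (h : IsPartList π fs) (x : X) : ∃ k, ∃ hk : k < fs.length, x ∈ fs[k] := by
  obtain ⟨A, hA, hx⟩ := π.exists_mem (Finset.mem_univ x)
  obtain ⟨k, hk, rfl⟩ := h.exists_index hA
  exact ⟨k, hk, List.mem_toFinset.1 hx⟩

theorem length_le (h : IsPartList π fs) : fs.length ≤ Fintype.card X := by
  rw [← List.length_map List.toFinset, ← List.toFinset_card_of_nodup h.nodup_map]
  refine (Finset.card_le_card fun A hA => ?_).trans π.card_parts_le_card
  exact (h.mem_iff A).1 (List.mem_toFinset.1 hA)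

end IsPartList

section Representation

variable {n : ℕ} {G : SimpleGraph (Fin n)} {M : OuterplanarEmbedding G}
  {es : List (Fin n × Fin n)} {π : Finpartition (Finset.univ : Finset M.IntFace)}
  {ps : List (List (List (Fin es.length)))} {fs : List (List M.IntFace)}

/-- The lists `ps` describe the faces in the lists `fs`. -/
def DescribesFaces (M : OuterplanarEmbedding G) (es : List (Fin n × Fin n))
    (fs : List (List M.IntFace)) (ps : List (List (List (Fin es.length)))) : Prop :=
  List.Forall₂ (List.Forall₂ fun (f : M.IntFace) (c : List (Fin es.length)) =>
      c.Nodup ∧ ∀ j, j ∈ c ↔ edgeAt es j ∈ M.faceEdges f.1) fs ps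

theorem DescribesFaces.markParts_apply (h : DescribesFaces M es fs ps) (j : Fin es.length) :
    markParts 0 (fun _ => (0, 0)) ps j
      = ((labelled 0 fs).filter fun y => edgeAt es j ∈ M.faceEdges y.2.1).foldl
        (fun x y => markOne y.1 x) (0, 0) :=
  OuterSpanner.markParts_apply (P := fun f : M.IntFace => edgeAt es j ∈ M.faceEdges f.1)
    (List.Forall₂.imp (fun _ _ h => List.Forall₂.imp (fun _ _ h => ⟨h.1, h.2 j⟩) h) h) 0 _

theorem nodup_map_snd_filter_labelled (hfs : IsPartList π fs) (P : ℕ × M.IntFace → Bool) :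
    (((labelled 0 fs).filter P).map Prod.snd).Nodup := by
  have := hfs.nodup_flatten
  rw [← map_snd_labelled fs 0] at this
  exact this.sublist (List.filter_sublist.map _)

theorem mem_filter_labelled {j : Fin es.length} {k : ℕ} {hk : k < fs.length} {f : M.IntFace}
    (hf : f ∈ fs[k]) (hef : edgeAt es j ∈ M.faceEdges f.1) : (k + 1, f) ∈
      (labelled 0 fs).filter fun y => edgeAt es j ∈ M.faceEdges y.2.1 :=
  List.mem_filter.2 ⟨mem_labelled.2 ⟨k, hk, by simp, hf⟩, by simpa using hef⟩

/-- One side of the edge is the exterior face, so `f` is its only interior face and it occurs once.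
-/
theorem markParts_of_external (hfs : IsPartList π fs) (h : DescribesFaces M es fs ps)
    {j : Fin es.length} {k : ℕ} {hk : k < fs.length} {f : M.IntFace} (hf : f ∈ fs[k])
    (hef : edgeAt es j ∈ M.faceEdges f.1) (he : edgeAt es j ∈ M.externalEdges) :
    markParts 0 (fun _ => (0, 0)) ps j = (k + 1, 1) := by
  rw [h.markParts_apply]
  refine foldl_markOne_of_unique (nodup_map_snd_filter_labelled hfs _)
    (mem_filter_labelled hf hef) (fun y' hy' => ?_) (Nat.succ_pos k)
  have := of_decide_eq_true (List.mem_filter.1 hy').2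
  rcases M.eq_or_eq_of_mem f.2 hef he this with h' | h'
  · exact Subtype.ext h'
  · exact (y'.2.2 h').elim

theorem markParts_of_internal (hfs : IsPartList π fs) (h : DescribesFaces M es fs ps)
    {j : Fin es.length} {k l : ℕ} {hk : k < fs.length} {hl : l < fs.length} {f g : M.IntFace}
    (hf : f ∈ fs[k]) (hg : g ∈ fs[l]) (hfg : f ≠ g) (hef : edgeAt es j ∈ M.faceEdges f.1)
    (heg : edgeAt es j ∈ M.faceEdges g.1) :
    (markParts 0 (fun _ => (0, 0)) ps j).2 = if k = l then 0 else 2 := by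
  rw [h.markParts_apply, foldl_markOne_of_pair (nodup_map_snd_filter_labelled hfs _)
    ((pairwise_labelled fs 0).sublist List.filter_sublist) (mem_filter_labelled hf hef)
    (mem_filter_labelled hg heg) hfg (fun y' hy' => ?_) (Nat.succ_pos k) (Nat.succ_pos l)]
  · simp
  · exact (M.eq_or_eq_of_mem (fun h => hfg (Subtype.ext h)) hef heg
      (of_decide_eq_true (List.mem_filter.1 hy').2)).imp Subtype.ext Subtype.ext

/-- The class of an edge is one if it is external, zero if it is internal to a part, and two if it
separates two parts. -/
theorem markParts_cases (hG : IsTwoConnected G) (hes : IsEdgeList G es) (hfs : IsPartList π fs)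
    (h : DescribesFaces M es fs ps) (j : Fin es.length) :
    ((markParts 0 (fun _ => (0, 0)) ps j).2 = 1 ∧ edgeAt es j ∈ M.externalEdges) ∨
    ((markParts 0 (fun _ => (0, 0)) ps j).2 = 0 ∧
      ∃ A ∈ π.parts, edgeAt es j ∈ M.partInternalEdges A) ∨
    ((markParts 0 (fun _ => (0, 0)) ps j).2 = 2 ∧ edgeAt es j ∉ M.externalEdges ∧
      ∀ A ∈ π.parts, edgeAt es j ∉ M.partInternalEdges A) := by
  have hmem : edgeAt es j ∈ G.edgeSet := hes.2 ▸ Set.mem_range_self j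
  obtain ⟨d, hd⟩ : ∃ d : G.Dart, d.edge = edgeAt es j := by
    generalize edgeAt es j = e at hmem
    induction e with | _ u v => exact ⟨⟨(u, v), hmem⟩, rfl⟩
  have hne := M.faceOf_symm_ne hG d
  have h1 : edgeAt es j ∈ M.faceEdges (M.faceOf d) := hd ▸ M.edge_mem_faceEdges.2 (Or.inl rfl)
  have h2 : edgeAt es j ∈ M.faceEdges (M.faceOf d.symm) :=
    hd ▸ M.edge_mem_faceEdges.2 (Or.inr rfl)
  by_cases he1 : M.faceOf d = M.ext
  · obtain ⟨k, hk, hf⟩ := hfs.exists_mem ⟨M.faceOf d.symm, he1 ▸ hne⟩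
    have he : edgeAt es j ∈ M.faceEdges M.ext := he1 ▸ h1
    exact Or.inl ⟨by rw [markParts_of_external hfs h hf h2 he], he⟩
  by_cases he2 : M.faceOf d.symm = M.ext
  · obtain ⟨k, hk, hf⟩ := hfs.exists_mem ⟨M.faceOf d, he1⟩
    have he : edgeAt es j ∈ M.faceEdges M.ext := he2 ▸ h2
    exact Or.inl ⟨by rw [markParts_of_external hfs h hf h1 he], he⟩
  right
  have hfg : (⟨M.faceOf d, he1⟩ : M.IntFace) ≠ ⟨M.faceOf d.symm, he2⟩ := fun h =>
    hne (Subtype.ext_iff.1 h).symm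
  obtain ⟨k, hk, hf⟩ := hfs.exists_mem ⟨M.faceOf d, he1⟩
  obtain ⟨l, hl, hg⟩ := hfs.exists_mem ⟨M.faceOf d.symm, he2⟩
  rw [markParts_of_internal hfs h hf hg hfg h1 h2]
  by_cases hkl : k = l
  · subst hkl
    exact Or.inl ⟨if_pos rfl, _, hfs.toFinset_mem hk, M.mem_partInternalEdges.2
      ⟨_, List.mem_toFinset.2 hf, _, List.mem_toFinset.2 hg, hfg, h1, h2⟩⟩
  · refine Or.inr ⟨if_neg hkl, fun he => ?_, fun A hA he => ?_⟩
    · rcases M.eq_or_eq_of_mem hne.symm h1 h2 he with h' | h'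
      exacts [he1 h'.symm, he2 h'.symm]
    · obtain ⟨i, hi, rfl⟩ := hfs.exists_index hA
      obtain ⟨f', hf', g', hg', hfg', hef', heg'⟩ := M.mem_partInternalEdges.1 he
      rw [List.mem_toFinset] at hf' hg'
      have hne' : f'.1 ≠ g'.1 := fun h => hfg' (Subtype.ext h)
      have key : ∀ x : M.IntFace, edgeAt es j ∈ M.faceEdges x.1 → x ∈ fs[i] := fun x hx => by
        rcases M.eq_or_eq_of_mem hne' hef' heg' hx with h' | h'
        · exact Subtype.ext h' ▸ hf'
        · exact Subtype.ext h' ▸ hg'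
      exact hkl ((hfs.index_unique hf (key ⟨_, he1⟩ h1)).trans
        (hfs.index_unique hg (key ⟨_, he2⟩ h2)).symm)

/-- One word per part, per face and per incidence of a face with an edge: at most `m + m + 2m`. -/
theorem length_partsWords_le (hG : IsTwoConnected G) (hes : IsEdgeList G es)
    (hfs : IsPartList π fs) (h : DescribesFaces M es fs ps) :
    (partsWords ps).length ≤ 4 * G.edgeSet.ncard := by
  have hpart : ∀ l part, List.Forall₂ (fun (f : M.IntFace) (c : List (Fin es.length)) =>
      c.Nodup ∧ ∀ j, j ∈ c ↔ edgeAt es j ∈ M.faceEdges f.1) l part →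
      (partWords part).length ≤ l.length + (l.map fun f => (M.faceEdges f.1).card).sum := by
    intro l part h
    induction h with
    | nil => simp [partWords]
    | @cons f c l part hfc _ ih =>
      have hc : c.length ≤ (M.faceEdges f.1).card := by
        rw [← List.length_map (edgeAt es), ← List.toFinset_card_of_nodup (hfc.1.map hes.1)]
        refine Finset.card_le_card fun e he => ?_
        obtain ⟨j, hj, rfl⟩ := List.mem_map.1 (List.mem_toFinset.1 he)
        exact (hfc.2 j).1 hj
      have : (partWords (c :: part)).length = c.length + 1 + (partWords part).length := by
        simp [partWords, Nat.add_right_comm]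
      simp only [this, List.length_cons, List.map_cons, List.sum_cons]
      omega
  have hparts : (partsWords ps).length ≤ fs.length + (fs.flatten.length
      + (fs.flatten.map fun f => (M.faceEdges f.1).card).sum) := by
    unfold DescribesFaces at h
    clear hfs
    induction h with
    | nil => simp [partsWords]
    | @cons l part fs ps hl _ ih =>
      have h1 := hpart l part hl
      have : (partsWords (part :: ps)).length
          = (partWords part).length + 1 + (partsWords ps).length := by
        simp [partsWords, Nat.add_right_comm]
      simp only [this, List.length_cons, List.flatten_cons, List.length_append, List.map_append,
        List.sum_append]
      omega
  have h1 := hfs.length_le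
  have h2 := hfs.nodup_flatten.length_le_card
  have h3 : (fs.flatten.map fun f => (M.faceEdges f.1).card).sum
      ≤ ∑ f : M.IntFace, (M.faceEdges f.1).card := by
    rw [← List.sum_toFinset _ hfs.nodup_flatten]
    exact Finset.sum_le_sum_of_subset (Finset.subset_univ _)
  have h4 := M.card_intFace_le hG
  have h5 := M.sum_card_faceEdges_le
  omega

theorem IsEdgeList.length_eq (hes : IsEdgeList G es) : G.edgeSet.ncard = es.length := by
  rw [← hes.2, Set.ncard_range_of_injective hes.1, Nat.card_eq_fintype_card, Fintype.card_fin]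

theorem isEdgeList_map_get {T : SimpleGraph (Fin n)} {js : List (Fin es.length)} (hjs : js.Nodup)
    (hinj : Function.Injective (edgeAt es))
    (hT : ∀ e, e ∈ T.edgeSet ↔ ∃ j ∈ js, edgeAt es j = e) : IsEdgeList T (js.map es.get) := by
  have key : ∀ (i : Fin (js.map es.get).length) (hi : i.1 < js.length),
      edgeAt (js.map es.get) i = edgeAt es js[i.1] := by
    intro i hi
    simp [edgeAt]
  have hlen : ∀ i : Fin (js.map es.get).length, i.1 < js.length := fun i => by
    simpa using i.2
  refine ⟨fun i i' h => ?_, Set.ext fun e => ?_⟩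
  · rw [key i (hlen i), key i' (hlen i')] at h
    exact Fin.ext (hjs.getElem_inj_iff.1 (hinj h))
  · rw [hT]
    constructor
    · rintro ⟨i, rfl⟩
      exact ⟨_, List.getElem_mem (hlen i), (key i (hlen i)).symm⟩
    · rintro ⟨j, hj, rfl⟩
      obtain ⟨i, hi, rfl⟩ := List.getElem_of_mem hj
      exact ⟨⟨i, by simpa using hi⟩, key _ hi⟩

/-- The kept edges form a graph that arises from `G` by the prescribed deletions. -/
theorem exists_isObtainedFrom (hG : IsTwoConnected G) (hes : IsEdgeList G es)
    (hπ : IsTreeSPartition M.weakDual M.special π) (hfs : IsPartList π fs)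
    (h : DescribesFaces M es fs ps) : ∃ T : SimpleGraph (Fin n), IsObtainedFrom M π T ∧
      IsEdgeList T (((List.finRange es.length).filter fun j =>
        isKept (markParts 0 (fun _ => (0, 0)) ps) j.1).map es.get) := by
  classical
  have hcases := markParts_cases hG hes hfs h
  -- The selected edge is the external edge of `A` listed first, the one that the program drops. It
  -- exists because `A` contains a special face.
  have hex : ∀ A : Finset M.IntFace, ∃ e : Sym2 (Fin n), A ∈ π.parts →
      ∃ j, edgeAt es j = e ∧ e ∈ M.externalEdges ∧ e ∈ M.partEdges A ∧
        ∀ i < j, edgeAt es i ∈ M.externalEdges → edgeAt es i ∉ M.partEdges A := by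
    intro A
    by_cases hA : A ∈ π.parts
    · obtain ⟨f, hf⟩ := Finset.card_pos.1 ((hπ A hA).2.symm ▸ Nat.one_pos)
      obtain ⟨hfA, hfS⟩ := Finset.mem_inter.1 hf
      obtain ⟨e, he⟩ := (Finset.mem_filter.1 hfS).2
      obtain ⟨hef, hext⟩ := Finset.mem_inter.1 he
      obtain ⟨j, rfl⟩ := (hes.2.symm ▸ M.mem_edgeSet_of_mem_faceEdges hef :
        e ∈ Set.range (edgeAt es))
      obtain ⟨i, hi, hmin⟩ := WellFounded.has_min (wellFounded_lt (α := Fin es.length))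
        {i | edgeAt es i ∈ M.externalEdges ∧ edgeAt es i ∈ M.partEdges A}
        ⟨j, hext, M.mem_partEdges.2 ⟨f, hfA, hef⟩⟩
      exact ⟨_, fun _ => ⟨i, rfl, hi.1, hi.2, fun i' hi' h1 h2 => hmin i' ⟨h1, h2⟩ hi'⟩⟩
    · obtain ⟨v⟩ := hG.connected.nonempty
      exact ⟨s(v, v), fun h => (hA h).elim⟩
  choose ε hε using hex
  have hnotint : ∀ e ∈ M.externalEdges, ∀ A, e ∉ M.partInternalEdges A := by
    intro e he A hA
    obtain ⟨f, -, g, -, hfg, hef, heg⟩ := M.mem_partInternalEdges.1 hA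
    rcases M.eq_or_eq_of_mem (fun h => hfg (Subtype.ext h)) hef heg he with h' | h'
    exacts [f.2 h'.symm, g.2 h'.symm]
  set st := markParts 0 (fun _ => (0, 0)) ps with hst
  have hpart : ∀ e ∈ M.externalEdges, ∀ A ∈ π.parts, ∀ A' ∈ π.parts, e ∈ M.partEdges A →
      e ∈ M.partEdges A' → A = A' := by
    intro e he A hA A' hA' h1 h2
    obtain ⟨f, hf, hef⟩ := M.mem_partEdges.1 h1
    obtain ⟨g, hg, heg⟩ := M.mem_partEdges.1 h2
    rcases M.eq_or_eq_of_mem f.2 hef he heg with h' | h'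
    · exact π.eq_of_mem_parts hA hA' hf (Subtype.ext h' ▸ hg)
    · exact (g.2 h').elim
  have hext : ∀ j, edgeAt es j ∈ M.externalEdges → ∃ k, ∃ hk : k < fs.length, ∃ f ∈ fs[k],
      edgeAt es j ∈ M.faceEdges f.1 ∧ st j = (k + 1, 1) := by
    intro j hj
    obtain ⟨d, hd, hdj⟩ := M.mem_faceEdges.1 hj
    have hef : edgeAt es j ∈ M.faceEdges (M.faceOf d.symm) :=
      hdj ▸ M.edge_mem_faceEdges.2 (Or.inr rfl)
    obtain ⟨k, hk, hf⟩ := hfs.exists_mem ⟨M.faceOf d.symm, hd ▸ M.faceOf_symm_ne hG d⟩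
    exact ⟨k, hk, _, hf, hef, markParts_of_external hfs h hf hef hj⟩
  -- An external edge has a single interior face, so equal labels mean the same part.
  have hlabel : ∀ j, edgeAt es j ∈ M.externalEdges → ∃ A ∈ π.parts, edgeAt es j ∈ M.partEdges A ∧
      ∀ i, edgeAt es i ∈ M.externalEdges →
        ((st i).1 = (st j).1 ↔ edgeAt es i ∈ M.partEdges A) := by
    intro j hj
    obtain ⟨k, hk, f, hf, hef, hst'⟩ := hext j hj
    refine ⟨_, hfs.toFinset_mem hk, M.mem_partEdges.2 ⟨f, List.mem_toFinset.2 hf, hef⟩,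
      fun i hi => ?_⟩
    obtain ⟨l, hl, g, hg, heg, hsti⟩ := hext i hi
    rw [hst', hsti]
    constructor
    · intro hlk
      obtain rfl : l = k := Nat.succ_injective hlk
      exact M.mem_partEdges.2 ⟨g, List.mem_toFinset.2 hg, heg⟩
    · intro hmem
      obtain ⟨g', hg', heg'⟩ := M.mem_partEdges.1 hmem
      rw [List.mem_toFinset] at hg'
      rcases M.eq_or_eq_of_mem g.2 heg hi heg' with h' | h'
      · rw [Subtype.ext h'] at hg'
        rw [hfs.index_unique hg hg']
      · exact (g'.2 h').elim
  refine ⟨_, ⟨ε, fun A hA => ?_, rfl⟩, isEdgeList_map_get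
    ((List.nodup_finRange _).filter _) hes.1 fun e => ?_⟩
  · obtain ⟨-, -, h1, h2, -⟩ := hε A hA
    exact Finset.mem_inter.2 ⟨Finset.mem_sdiff.2 ⟨h2, hnotint _ h1 A⟩, h1⟩
  · have key : ∀ j : Fin es.length, isKept st j.1 = true ↔
        (¬ ∃ A ∈ π.parts, edgeAt es j ∈ M.partInternalEdges A) ∧
          ¬ ∃ A ∈ π.parts, edgeAt es j = ε A := by
      intro j
      rw [isKept_iff]
      have hle := foundAt_le_one st j.1 (st j.1).1
      rcases hcases j with ⟨h2, he⟩ | ⟨h2, hA⟩ | ⟨h2, he, hA⟩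
      · obtain ⟨A, hA, heA, hlab⟩ := hlabel j he
        have hfound : foundAt st j.1 (st j.1).1 = 1 ↔
            ∃ i < j, edgeAt es i ∈ M.externalEdges ∧ edgeAt es i ∈ M.partEdges A := by
          rw [foundAt_eq_one]
          constructor
          · rintro ⟨i, hij, hi1, hi2⟩
            have hcase := hcases ⟨i, hij.trans j.2⟩
            have hie : edgeAt es ⟨i, hij.trans j.2⟩ ∈ M.externalEdges := by
              simp only [hi1] at hcase
              simpa using hcase
            exact ⟨⟨i, hij.trans j.2⟩, hij, hie, (hlab _ hie).1 hi2⟩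
          · rintro ⟨i, hij, hie, hiA⟩
            obtain ⟨k, hk, f, hf, hef, hsti⟩ := hext i hie
            exact ⟨i.1, hij, by rw [hsti], (hlab i hie).2 hiA⟩
        -- The class being 1, the edge is kept exactly if its part has an earlier external edge.
        have h3 : 2 ≤ foundAt st j.1 (st j.1).1 + (st j.1).2 ↔ foundAt st j.1 (st j.1).1 = 1 := by
          omega
        rw [h3, hfound]
        constructor
        · rintro ⟨i, hij, hie, hiA⟩
          refine ⟨fun ⟨A', _, h'⟩ => hnotint _ he A' h', ?_⟩
          rintro ⟨A', hA', hjA'⟩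
          obtain ⟨j', hj', h4, h5, h6⟩ := hε A' hA'
          obtain rfl : j' = j := hes.1 (hj'.trans hjA'.symm)
          rw [← hj'] at h5
          exact h6 i hij hie (hpart _ he A hA A' hA' heA h5 ▸ hiA)
        · rintro ⟨-, hno⟩
          obtain ⟨j', hj', h4, h5, h6⟩ := hε A hA
          rw [← hj'] at h4 h5
          rcases lt_trichotomy j' j with hlt | rfl | hlt
          · exact ⟨j', hlt, h4, h5⟩
          · exact (hno ⟨A, hA, hj'⟩).elim
          · exact (h6 j hlt he heA).elim
      · exact iff_of_false (by omega) fun h' => h'.1 hA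
      · refine iff_of_true (by omega) ⟨fun ⟨A, hA', h'⟩ => hA A hA' h', fun ⟨A, hA', h'⟩ => he ?_⟩
        obtain ⟨-, -, h1, -⟩ := hε A hA'
        exact h' ▸ h1
    rw [SimpleGraph.edgeSet_deleteEdges, SimpleGraph.edgeSet_deleteEdges]
    constructor
    · rintro ⟨⟨h1, h2⟩, h3⟩
      obtain ⟨j, rfl⟩ := (hes.2.symm ▸ h1 : e ∈ Set.range (edgeAt es))
      exact ⟨j, List.mem_filter.2 ⟨List.mem_finRange j, (key j).2 ⟨h2, h3⟩⟩, rfl⟩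
    · rintro ⟨j, hj, rfl⟩
      have := (key j).1 (List.mem_filter.1 hj).2
      exact ⟨⟨hes.2 ▸ Set.mem_range_self j, this.1⟩, this.2⟩

end Representation

end OuterSpanner

open OuterSpanner
theorem mainTheorem6 :
    ∃ (P : Prog) (c : ℕ),
      ∀ (n : ℕ) (G : SimpleGraph (Fin n)), IsTwoConnected G →
      ∀ (M : OuterplanarEmbedding G) (t : ℕ) (π : Finpartition (Finset.univ : Finset M.IntFace)),
        IsTreeSPartition M.weakDual M.special π →
        (partitionCost M.weight π : ℤ) ≤ (t : ℤ) - 1 →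
      ∀ (es : List (Fin n × Fin n)) (ps : List (List (List (Fin es.length)))),
        IsEdgeList G es → RepresentsPartition M es π ps →
      ∃ (k : ℕ) (s : Memory) (T : SimpleGraph (Fin n)) (es' : List (Fin n × Fin n)),
        Exec (c * n) P (initialMemory (graphWords es ++ partitionWords ps)) k s ∧
        k ≤ c * n ∧
        HasOutput s (graphWords es') ∧
        IsEdgeList T es' ∧
        IsTreeSpanner G T t ∧
        IsObtainedFrom M π T := by
  -- With `m ≤ 2n - 3` and at most `4m` words for the parts, the run takes at most `80m + 14 ≤ 160n`
  -- steps and needs numbers up to `6m + 3`; 200 leaves slack.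
  refine ⟨spannerProg, 200, fun n G hG M t π hπ ht es ps hes ⟨fs, h1, h2, h3, h⟩ => ?_⟩
  have hfs : IsPartList π fs := ⟨h1, h2, h3⟩
  have hm := M.card_edgeSet_add_three_le hG
  have hw := length_partsWords_le hG hes hfs h
  rw [hes.length_eq] at hm hw
  rw [Fintype.card_fin] at hm
  have hst : ∀ j < es.length, (markParts 0 (fun _ => (0, 0)) ps j).2 ≤ 2 := fun j hj => by
    have := markParts_cases hG hes hfs h ⟨j, hj⟩
    simp only at this
    omega
  obtain ⟨k, s, hexec, hk, hout⟩ := spannerProg_runs (W := 200 * n) hst (by omega)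
  obtain ⟨T, hT, hTes⟩ := exists_isObtainedFrom hG hes hπ hfs h
  exact ⟨k, s, T, _, hexec, by omega, hout, hTes,
    M.isTreeSpanner_of_isObtainedFrom π hG.connected hπ ht hT, hT⟩
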